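/- **Definitions.** An *Ann-category* is a category $\mathcal A$ with bifunctors $\oplus,\otimes$ such that $(\mathcal A,\oplus,a^+,c^+,(0,g,d))$ is a symmetric categorical group (a symmetric monoidal groupoid in which every object is $\oplus$-invertible, with unit constraints $g_X:0\oplus X\to X$, $d_X:X\oplus 0\to X$), $(\mathcal A,\otimes,a,(1,l,r))$ is a monoidal category, and there are natural isomorphisms $\mathfrak L_{A,X,Y}:A(X\oplus Y)\to AX\oplus AY$, $\mathfrak R_{X,Y,A}:(X\oplus Y)A\to XA\oplus YA$ which are compatible with $a^+$, $c^+$, $a$, $l$, $r$ and with each other (for $(A\oplus B)(X\oplus Y)$). It is *braided* if it has a braiding $c$ for $\otimes$ with $(c_{A,X}\oplus c_{A,Y})\circ\mathfrak L_{A,X,Y}=\mathfrak R_{X,Y,A}\circ c_{A,X\oplus Y}$ and $c_{0,0}=\mathrm{id}$. A *braided Ann-functor* $(F,\breve F,\tilde F,F_*)$ is a functor with natural isomorphisms $\breve F$ (for $\oplus$) and $\tilde F$ (for $\otimes$), and an isomorphism $F_*$ of unit objects for $\otimes$, such that $(F,\breve F)$ is compatible with $a^+,c^+$, $(F,\tilde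 F,F_*)$ is braided monoidal for $\otimes$, and $F$ is compatible with $\mathfrak L,\mathfrak R$. It is a *braided Ann-equivalence* if there are a braided Ann-functor $K$ in the other direction and natural isomorphisms $KF\cong\mathrm{id}$, $FK\cong\mathrm{id}$ which are monoidal for both $\oplus$ and $\otimes$. Let $\mathcal A$ be a braided Ann-category. Let $\pi_0\mathcal A$ be the set of isomorphism classes of objects with $[X]+[Y]=[X\oplus Y]$, $[X][Y]=[X\otimes Y]$, and $\pi_1\mathcal A=\mathrm{Aut}(0)$, an abelian group written additively. For an object $X$ let $\gamma_X:\mathrm{Aut}(0)\to\mathrm{Aut}(X)$ be the isomorphism $\gamma_X(u)=g_X\circ(u\oplus\mathrm{id})\circ g_X^{-1}$; let $\hat L^X:X\otimes 0\to 0$ and $\hat R^X:0\otimes X\to 0$ be the isomorphisms induced by the $\oplus$-functors $X\otimes-$ and $-\otimes X$; for $u\in\pi_1\mathcal A$ and $X\in s\in\pi_0\mathcal A$ put $su=\hat L^X(\mathrm{id}\otimes u)(\hat L^X)^{-1}$ and $us=\hat R^X(u\otimes\mathrm{id})(\hat R^X)^{-1}$. A *stick* consists of representatives $X_s\in s$ ($s\in\pi_0\mathcal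 A$) with $X_0=0$, $X_1=1$ and isomorphisms $\varphi_{s,t}:X_s\oplus X_t\to X_{s+t}$, $\psi_{s,t}:X_s\otimes X_t\to X_{st}$ with $\varphi_{0,t}=g_{X_t}$, $\varphi_{s,0}=d_{X_s}$, $\psi_{1,t}=l_{X_t}$, $\psi_{s,1}=r_{X_s}$, $\psi_{0,t}=\hat R^{X_t}$, $\psi_{s,0}=\hat L^{X_s}$. Fix a stick and isomorphisms $i_X:X\to X_{[X]}$ for all objects $X$, with $i_{X_s}=\mathrm{id}$. The *reduced Ann-category* $s\mathcal A$ has the elements of $\pi_0\mathcal A$ as objects and only automorphisms $(s,u):s\to s$, $u\in\pi_1\mathcal A$, as morphisms, with $(s,u)\circ(s,v)=(s,u+v)$, $(s,u)\oplus(t,v)=(s+t,u+v)$, $(s,u)\otimes(t,v)=(st,sv+ut)$; its unit constraints are $(0,\mathrm{id},\mathrm{id})$ and $(1,\mathrm{id},\mathrm{id})$, and its other constraints are those which correspond to the constraints $a^+,c^+,a,\mathfrak L,\mathfrak R$ of $\mathcal A$ under the fully faithful functor $H:s\mathcal A\to\mathcal A$, $H(s)=X_s$, $H(s,u)=\gamma_{X_s}(u)$,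 with $\breve H=\varphi^{-1}$, $\tilde H=\psi^{-1}$, $H_*=\mathrm{id}_1$. The functor $G:\mathcal A\to s\mathcal A$ is $G(X)=[X]$, $G(f)=(s,\gamma_{X_s}^{-1}(i_Y f i_X^{-1}))$ for $f:X\to Y$, $X,Y\in s$, with $\breve G_{X,Y}=G(\varphi_{s,t}\circ(i_X\oplus i_Y))$, $\tilde G_{X,Y}=G(\psi_{s,t}\circ(i_X\otimes i_Y))$ for $X\in s$, $Y\in t$, and $G_*=\mathrm{id}_1$. **Proposition.** There is a unique map $\beta:\pi_0\mathcal A\times\pi_0\mathcal A\to\pi_1\mathcal A$ with $$\gamma_{X_{rs}}(\beta(r,s))\circ\psi_{r,s}=\psi_{s,r}\circ c_{X_r,X_s}\qquad(r,s\in\pi_0\mathcal A),$$ and $s\mathcal A$ with $c'_{r,s}=(rs,\beta(r,s)):rs\to sr$ is a braided Ann-category. With this braiding, $(H,\breve H,\tilde H,H_*)$ and $(G,\breve G,\tilde G,G_*)$ are braided Ann-equivalences. Moreover, if $\varphi_{s,t}=i_{X_s\oplus X_t}$ and $\psi_{s,t}=i_{X_s\otimes X_t}$ for all $s,t$, then $\breve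 G_{X,Y}=G(i_X\oplus i_Y)$ and $\tilde G_{X,Y}=G(i_X\otimes i_Y)$. -/

import Mathlib

open CategoryTheory

universe u v u' v' u'' v''

/-! ### Monoidal data satisfying Mathlib's axioms -/

/-- The given product, unit object and constraints form a monoidal category. -/
def IsMonoidal {C : Type u} [Category.{v} C] (m : MonoidalCategoryStruct C) : Prop :=
  ∃ M : MonoidalCategory C, M.toMonoidalCategoryStruct = m

/-- The Mathlib monoidal category whose data are exactly `m`. -/
abbrev IsMonoidal.monoidal {C : Type u} [Category.{v} C] {m : MonoidalCategoryStruct C}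
    (h : IsMonoidal m) : MonoidalCategory C :=
  { m with
    tensorHom_def := by obtain ⟨M, rfl⟩ := h; exact M.tensorHom_def
    id_tensorHom_id := by obtain ⟨M, rfl⟩ := h; exact M.id_tensorHom_id
    tensorHom_comp_tensorHom := by obtain ⟨M, rfl⟩ := h; exact M.tensorHom_comp_tensorHom
    whiskerLeft_id := by obtain ⟨M, rfl⟩ := h; exact M.whiskerLeft_id
    id_whiskerRight := by obtain ⟨M, rfl⟩ := h; exact M.id_whiskerRight
    associator_naturality := by obtain ⟨M, rfl⟩ := h; exact M.associator_naturality
    leftUnitor_naturality := by obtain ⟨M, rfl⟩ := h; exact M.leftUnitor_naturality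
    rightUnitor_naturality := by obtain ⟨M, rfl⟩ := h; exact M.rightUnitor_naturality
    pentagon := by obtain ⟨M, rfl⟩ := h; exact M.pentagon
    triangle := by obtain ⟨M, rfl⟩ := h; exact M.triangle }

/-- The given isomorphisms are a braiding (natural, with both hexagon axioms). -/
def IsBraiding {C : Type u} [Category.{v} C] {m : MonoidalCategoryStruct C} (h : IsMonoidal m)
    (c : ∀ X Y : C, m.tensorObj X Y ≅ m.tensorObj Y X) : Prop :=
  ∃ B : @BraidedCategory C _ h.monoidal, ∀ X Y, B.braiding X Y = c X Y

/-- The given isomorphisms are a symmetry: a braiding with `c_{Y,X} ∘ c_{X,Y} = id`. -/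
def IsSymmetry {C : Type u} [Category.{v} C] {m : MonoidalCategoryStruct C} (h : IsMonoidal m)
    (c : ∀ X Y : C, m.tensorObj X Y ≅ m.tensorObj Y X) : Prop :=
  ∃ B : @SymmetricCategory C _ h.monoidal, ∀ X Y, B.braiding X Y = c X Y

/-! ### Ann-categories -/

/-- The data of an Ann-category on `C`: the operations `⊕` (`add`) and `⊗` (`mul`) with their
unit objects and associativity and unit constraints, the commutativity constraint of `⊕` and the
two distributivity constraints. -/
structure AnnData (C : Type u) [Category.{v} C] where
  add : MonoidalCategoryStruct C
  mul : MonoidalCategoryStruct C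
  addComm : ∀ X Y : C, add.tensorObj X Y ≅ add.tensorObj Y X
  distL : ∀ A X Y : C, mul.tensorObj A (add.tensorObj X Y) ≅
    add.tensorObj (mul.tensorObj A X) (mul.tensorObj A Y)
  distR : ∀ X Y A : C, mul.tensorObj (add.tensorObj X Y) A ≅
    add.tensorObj (mul.tensorObj X A) (mul.tensorObj Y A)

namespace AnnData

section
variable {C : Type u} [Category.{v} C] (D : AnnData C)

/-- `X ⊕ Y`. -/
abbrev plus (X Y : C) : C := D.add.tensorObj X Y

/-- `X ⊗ Y`. -/
abbrev times (X Y : C) : C := D.mul.tensorObj X Y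

/-- The object `0`. -/
abbrev zero : C := D.add.tensorUnit

/-- The object `1`. -/
abbrev one : C := D.mul.tensorUnit

/-- `f ⊕ g` on morphisms. -/
abbrev plusHom {X X' Y Y' : C} (f : X ⟶ X') (g : Y ⟶ Y') : D.plus X Y ⟶ D.plus X' Y' :=
  D.add.tensorHom f g

/-- `f ⊗ g` on morphisms. -/
abbrev timesHom {X X' Y Y' : C} (f : X ⟶ X') (g : Y ⟶ Y') : D.times X Y ⟶ D.times X' Y' :=
  D.mul.tensorHom f g

/-- The interchange `(U ⊕ V) ⊕ (Z ⊕ T) ⟶ (U ⊕ Z) ⊕ (V ⊕ T)` built from the associativity and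
commutativity constraints of `⊕`. -/
def interchange (U V Z T : C) :
    D.plus (D.plus U V) (D.plus Z T) ⟶ D.plus (D.plus U Z) (D.plus V T) :=
  (D.add.associator U V (D.plus Z T)).hom ≫
    D.plusHom (𝟙 U) ((D.add.associator V Z T).inv ≫
      D.plusHom (D.addComm V Z).hom (𝟙 T) ≫ (D.add.associator Z V T).hom) ≫
    (D.add.associator U Z (D.plus V T)).inv

/-- The axioms of an Ann-category. -/
structure IsAnn : Prop where
  add_monoidal : IsMonoidal D.add
  add_symmetry : IsSymmetry add_monoidal D.addComm
  isGroupoid : IsGroupoid C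
  exists_neg : ∀ X : C, ∃ Y : C, Nonempty (D.plus X Y ≅ D.zero)
  mul_monoidal : IsMonoidal D.mul
  distL_natural : ∀ {A A' X X' Y Y' : C} (f : A ⟶ A') (g : X ⟶ X') (h : Y ⟶ Y'),
    D.timesHom f (D.plusHom g h) ≫ (D.distL A' X' Y').hom =
      (D.distL A X Y).hom ≫ D.plusHom (D.timesHom f g) (D.timesHom f h)
  distR_natural : ∀ {X X' Y Y' A A' : C} (g : X ⟶ X') (h : Y ⟶ Y') (f : A ⟶ A'),
    D.timesHom (D.plusHom g h) f ≫ (D.distR X' Y' A').hom =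
      (D.distR X Y A).hom ≫ D.plusHom (D.timesHom g f) (D.timesHom h f)
  /-- `A ⊗ -` is compatible with the associativity constraint of `⊕`. -/
  distL_assoc : ∀ A X Y Z : C,
    D.timesHom (𝟙 A) (D.add.associator X Y Z).hom ≫ (D.distL A X (D.plus Y Z)).hom ≫
        D.plusHom (𝟙 (D.times A X)) (D.distL A Y Z).hom =
      (D.distL A (D.plus X Y) Z).hom ≫ D.plusHom (D.distL A X Y).hom (𝟙 (D.times A Z)) ≫
        (D.add.associator (D.times A X) (D.times A Y) (D.times A Z)).hom
  /-- `A ⊗ -` is compatible with the commutativity constraint of `⊕`. -/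
  distL_comm : ∀ A X Y : C,
    D.timesHom (𝟙 A) (D.addComm X Y).hom ≫ (D.distL A Y X).hom =
      (D.distL A X Y).hom ≫ (D.addComm (D.times A X) (D.times A Y)).hom
  /-- `- ⊗ A` is compatible with the associativity constraint of `⊕`. -/
  distR_assoc : ∀ X Y Z A : C,
    D.timesHom (D.add.associator X Y Z).hom (𝟙 A) ≫ (D.distR X (D.plus Y Z) A).hom ≫
        D.plusHom (𝟙 (D.times X A)) (D.distR Y Z A).hom =
      (D.distR (D.plus X Y) Z A).hom ≫ D.plusHom (D.distR X Y A).hom (𝟙 (D.times Z A)) ≫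
        (D.add.associator (D.times X A) (D.times Y A) (D.times Z A)).hom
  /-- `- ⊗ A` is compatible with the commutativity constraint of `⊕`. -/
  distR_comm : ∀ X Y A : C,
    D.timesHom (D.addComm X Y).hom (𝟙 A) ≫ (D.distR Y X A).hom =
      (D.distR X Y A).hom ≫ (D.addComm (D.times X A) (D.times Y A)).hom
  /-- The two ways `(A B)(X ⊕ Y) ⟶ A(B X) ⊕ A(B Y)` agree. -/
  distL_mul : ∀ A B X Y : C,
    (D.mul.associator A B (D.plus X Y)).hom ≫ D.timesHom (𝟙 A) (D.distL B X Y).hom ≫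
        (D.distL A (D.times B X) (D.times B Y)).hom =
      (D.distL (D.times A B) X Y).hom ≫
        D.plusHom (D.mul.associator A B X).hom (D.mul.associator A B Y).hom
  /-- The two ways `((X ⊕ Y) B) A ⟶ X(B A) ⊕ Y(B A)` agree. -/
  distR_mul : ∀ X Y B A : C,
    (D.mul.associator (D.plus X Y) B A).hom ≫ (D.distR X Y (D.times B A)).hom =
      D.timesHom (D.distR X Y B).hom (𝟙 A) ≫ (D.distR (D.times X B) (D.times Y B) A).hom ≫
        D.plusHom (D.mul.associator X B A).hom (D.mul.associator Y B A).hom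
  /-- The two ways `(A (X ⊕ Y)) B ⟶ A(X B) ⊕ A(Y B)` agree. -/
  distL_distR : ∀ A X Y B : C,
    (D.mul.associator A (D.plus X Y) B).hom ≫ D.timesHom (𝟙 A) (D.distR X Y B).hom ≫
        (D.distL A (D.times X B) (D.times Y B)).hom =
      D.timesHom (D.distL A X Y).hom (𝟙 B) ≫ (D.distR (D.times A X) (D.times A Y) B).hom ≫
        D.plusHom (D.mul.associator A X B).hom (D.mul.associator A Y B).hom
  /-- The two ways `(A ⊕ B)(X ⊕ Y) ⟶ (A X ⊕ A Y) ⊕ (B X ⊕ B Y)` agree. -/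
  dist_interchange : ∀ A B X Y : C,
    (D.distL (D.plus A B) X Y).hom ≫ D.plusHom (D.distR A B X).hom (D.distR A B Y).hom ≫
        D.interchange (D.times A X) (D.times B X) (D.times A Y) (D.times B Y) =
      (D.distR A B (D.plus X Y)).hom ≫ D.plusHom (D.distL A X Y).hom (D.distL B X Y).hom
  distL_one : ∀ X Y : C,
    (D.distL D.one X Y).hom ≫ D.plusHom (D.mul.leftUnitor X).hom (D.mul.leftUnitor Y).hom =
      (D.mul.leftUnitor (D.plus X Y)).hom
  distR_one : ∀ X Y : C,
    (D.distR X Y D.one).hom ≫ D.plusHom (D.mul.rightUnitor X).hom (D.mul.rightUnitor Y).hom =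
      (D.mul.rightUnitor (D.plus X Y)).hom

end

end AnnData

/-- An Ann-category structure on `C`. -/
structure AnnCategory (C : Type u) [Category.{v} C] extends AnnData C where
  isAnn : toAnnData.IsAnn

/-! ### Braided Ann-categories -/

/-- The data of a braided Ann-category: those of an Ann-category and a family of isomorphisms
`X ⊗ Y ≅ Y ⊗ X`. -/
structure BraidedAnnData (C : Type u) [Category.{v} C] extends AnnData C where
  comm : ∀ X Y : C, toAnnData.times X Y ≅ toAnnData.times Y X

/-- The axioms of a braided Ann-category. -/
structure BraidedAnnData.IsBraidedAnn {C : Type u} [Category.{v} C] (D : BraidedAnnData C) :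
    Prop where
  isAnn : D.toAnnData.IsAnn
  comm_braiding : IsBraiding isAnn.mul_monoidal D.comm
  comm_dist : ∀ A X Y : C,
    (D.distL A X Y).hom ≫ D.plusHom (D.comm A X).hom (D.comm A Y).hom =
      (D.comm A (D.plus X Y)).hom ≫ (D.distR X Y A).hom
  comm_zero_zero : D.comm D.zero D.zero = Iso.refl _

/-- A braided Ann-category structure on `C`. -/
structure BraidedAnnCategory (C : Type u) [Category.{v} C] extends
    AnnCategory C, BraidedAnnData C where
  isBraidedAnn : toBraidedAnnData.IsBraidedAnn

/-! ### Braided Ann-functors -/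

/-- The data `(F, F̆, F̃, F_*)` of an Ann-functor. The isomorphisms `addIso` and `mulIso` go from
`FX ⊕ FY` to `F(X ⊕ Y)` and from `FX ⊗ FY` to `F(X ⊗ Y)`. -/
structure AnnFunctorData {C : Type u} [Category.{v} C] {C' : Type u'} [Category.{v'} C']
    (D : AnnData C) (E : AnnData C') where
  functor : C ⥤ C'
  addIso : ∀ X Y : C, E.plus (functor.obj X) (functor.obj Y) ≅ functor.obj (D.plus X Y)
  mulIso : ∀ X Y : C, E.times (functor.obj X) (functor.obj Y) ≅ functor.obj (D.times X Y)
  oneIso : E.one ≅ functor.obj D.one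

namespace AnnFunctorData

section
variable {C : Type u} [Category.{v} C] {C' : Type u'} [Category.{v'} C']
  {C'' : Type u''} [Category.{v''} C'']

/-- The identity functor with identity constraints. -/
def id (D : AnnData C) : AnnFunctorData D D where
  functor := 𝟭 C
  addIso _ _ := Iso.refl _
  mulIso _ _ := Iso.refl _
  oneIso := Iso.refl _

/-- The composite `K ∘ F`. -/
def comp {D : AnnData C} {E : AnnData C'} {E' : AnnData C''}
    (F : AnnFunctorData D E) (K : AnnFunctorData E E') : AnnFunctorData D E' where
  functor := F.functor ⋙ K.functor
  addIso X Y := K.addIso (F.functor.obj X) (F.functor.obj Y) ≪≫ K.functor.mapIso (F.addIso X Y)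
  mulIso X Y := K.mulIso (F.functor.obj X) (F.functor.obj Y) ≪≫ K.functor.mapIso (F.mulIso X Y)
  oneIso := K.oneIso ≪≫ K.functor.mapIso F.oneIso

/-- `(F, F̆, F̃, F_*)` is a braided Ann-functor: `(F, F̆)` is natural and compatible with the
associativity and commutativity constraints of `⊕`, `(F, F̃, F_*)` is a braided monoidal functor
for `⊗`, and `F` is compatible with the distributivity constraints. -/
structure IsBraidedAnnFunctor (D : BraidedAnnData C) (E : BraidedAnnData C')
    (F : AnnFunctorData D.toAnnData E.toAnnData) : Prop where
  add_natural : ∀ {X X' Y Y' : C} (f : X ⟶ X') (g : Y ⟶ Y'),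
    E.plusHom (F.functor.map f) (F.functor.map g) ≫ (F.addIso X' Y').hom =
      (F.addIso X Y).hom ≫ F.functor.map (D.plusHom f g)
  add_assoc : ∀ X Y Z : C,
    E.plusHom (F.addIso X Y).hom (𝟙 (F.functor.obj Z)) ≫ (F.addIso (D.plus X Y) Z).hom ≫
        F.functor.map (D.add.associator X Y Z).hom =
      (E.add.associator (F.functor.obj X) (F.functor.obj Y) (F.functor.obj Z)).hom ≫
        E.plusHom (𝟙 (F.functor.obj X)) (F.addIso Y Z).hom ≫ (F.addIso X (D.plus Y Z)).hom
  add_comm : ∀ X Y : C,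
    (F.addIso X Y).hom ≫ F.functor.map (D.addComm X Y).hom =
      (E.addComm (F.functor.obj X) (F.functor.obj Y)).hom ≫ (F.addIso Y X).hom
  mul_natural : ∀ {X X' Y Y' : C} (f : X ⟶ X') (g : Y ⟶ Y'),
    E.timesHom (F.functor.map f) (F.functor.map g) ≫ (F.mulIso X' Y').hom =
      (F.mulIso X Y).hom ≫ F.functor.map (D.timesHom f g)
  mul_assoc : ∀ X Y Z : C,
    E.timesHom (F.mulIso X Y).hom (𝟙 (F.functor.obj Z)) ≫ (F.mulIso (D.times X Y) Z).hom ≫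
        F.functor.map (D.mul.associator X Y Z).hom =
      (E.mul.associator (F.functor.obj X) (F.functor.obj Y) (F.functor.obj Z)).hom ≫
        E.timesHom (𝟙 (F.functor.obj X)) (F.mulIso Y Z).hom ≫ (F.mulIso X (D.times Y Z)).hom
  one_mul : ∀ X : C,
    (E.mul.leftUnitor (F.functor.obj X)).hom =
      E.timesHom F.oneIso.hom (𝟙 (F.functor.obj X)) ≫ (F.mulIso D.one X).hom ≫
        F.functor.map (D.mul.leftUnitor X).hom
  mul_one : ∀ X : C,
    (E.mul.rightUnitor (F.functor.obj X)).hom =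
      E.timesHom (𝟙 (F.functor.obj X)) F.oneIso.hom ≫ (F.mulIso X D.one).hom ≫
        F.functor.map (D.mul.rightUnitor X).hom
  mul_comm : ∀ X Y : C,
    (F.mulIso X Y).hom ≫ F.functor.map (D.comm X Y).hom =
      (E.comm (F.functor.obj X) (F.functor.obj Y)).hom ≫ (F.mulIso Y X).hom
  distL : ∀ X Y Z : C,
    E.timesHom (𝟙 (F.functor.obj X)) (F.addIso Y Z).hom ≫ (F.mulIso X (D.plus Y Z)).hom ≫
        F.functor.map (D.distL X Y Z).hom =
      (E.distL (F.functor.obj X) (F.functor.obj Y) (F.functor.obj Z)).hom ≫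
        E.plusHom (F.mulIso X Y).hom (F.mulIso X Z).hom ≫
        (F.addIso (D.times X Y) (D.times X Z)).hom
  distR : ∀ X Y Z : C,
    E.timesHom (F.addIso X Y).hom (𝟙 (F.functor.obj Z)) ≫ (F.mulIso (D.plus X Y) Z).hom ≫
        F.functor.map (D.distR X Y Z).hom =
      (E.distR (F.functor.obj X) (F.functor.obj Y) (F.functor.obj Z)).hom ≫
        E.plusHom (F.mulIso X Z).hom (F.mulIso Y Z).hom ≫
        (F.addIso (D.times X Z) (D.times Y Z)).hom

/-- A (braided) Ann-morphism: a natural transformation which is an `⊕`-morphism and an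
`⊗`-morphism. -/
structure IsAnnMorphism {D : AnnData C} {E : AnnData C'} (F K : AnnFunctorData D E)
    (t : F.functor ⟶ K.functor) : Prop where
  add : ∀ X Y : C, (F.addIso X Y).hom ≫ t.app (D.plus X Y) =
    E.plusHom (t.app X) (t.app Y) ≫ (K.addIso X Y).hom
  mul : ∀ X Y : C, (F.mulIso X Y).hom ≫ t.app (D.times X Y) =
    E.timesHom (t.app X) (t.app Y) ≫ (K.mulIso X Y).hom
  one : F.oneIso.hom ≫ t.app D.one = K.oneIso.hom

/-- `F` is a braided Ann-equivalence: it is a braided Ann-functor and there are a braided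
Ann-functor `K` in the other direction and invertible Ann-morphisms from `K ∘ F` and `F ∘ K` to
the identity functors. -/
def IsBraidedAnnEquivalence (D : BraidedAnnData C) (E : BraidedAnnData C')
    (F : AnnFunctorData D.toAnnData E.toAnnData) : Prop :=
  IsBraidedAnnFunctor D E F ∧
    ∃ K : AnnFunctorData E.toAnnData D.toAnnData, IsBraidedAnnFunctor E D K ∧
      (∃ t : F.functor ⋙ K.functor ≅ 𝟭 C,
        IsAnnMorphism (F.comp K) (AnnFunctorData.id D.toAnnData) t.hom) ∧
      (∃ t : K.functor ⋙ F.functor ≅ 𝟭 C',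
        IsAnnMorphism (K.comp F) (AnnFunctorData.id E.toAnnData) t.hom)

end

end AnnFunctorData

/-! ### The category underlying the reduced Ann-category -/

/-- `π₀`: the isomorphism classes of objects. It is the set of objects of the reduced category. -/
def AnnData.Reduced {C : Type u} [Category.{v} C] (_D : AnnData C) : Type u :=
  Quotient (isIsomorphicSetoid C)

/-- The isomorphism class of an object. -/
def AnnData.cls {C : Type u} [Category.{v} C] (D : AnnData C) (X : C) : D.Reduced :=
  Quotient.mk (isIsomorphicSetoid C) X

/-- A morphism `r ⟶ s` of the reduced category exists only for `r = s`, and then it is an element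
of `π₁ = Aut(0)`. -/
@[ext]
structure AnnData.ReducedHom {C : Type u} [Category.{v} C] (D : AnnData C)
    (r s : D.Reduced) : Type v where
  eq : r = s
  aut : Aut D.zero

/-- The composition is the group law of `π₁ = Aut(0)`. -/
instance AnnData.reducedCategory {C : Type u} [Category.{v} C] (D : AnnData C) :
    Category.{v} D.Reduced where
  Hom r s := D.ReducedHom r s
  id r := ⟨rfl, 1⟩
  comp f g := ⟨f.eq.trans g.eq, g.aut * f.aut⟩
  id_comp f := by cases f; simp
  comp_id f := by cases f; simp
  assoc f g h := by simp [mul_assoc]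

/-- The isomorphism `(r, a) : r ⟶ s`, for `r = s`. -/
def AnnData.reducedIso {C : Type u} [Category.{v} C] (D : AnnData C) {r s : D.Reduced}
    (h : r = s) (a : Aut D.zero) : r ≅ s where
  hom := ⟨h, a⟩
  inv := ⟨h.symm, a⁻¹⟩
  hom_inv_id := AnnData.ReducedHom.ext (inv_mul_cancel a)
  inv_hom_id := AnnData.ReducedHom.ext (mul_inv_cancel a)

namespace AnnCategory

section
variable {C : Type u} [Category.{v} C] (A : AnnCategory C)

theorem cls_eq {X Y : C} (e : X ≅ Y) : A.cls X = A.cls Y :=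
  Quotient.sound (s := isIsomorphicSetoid C) ⟨e⟩

theorem iso_of_cls_eq {X Y : C} (h : A.cls X = A.cls Y) : Nonempty (X ≅ Y) :=
  Quotient.exact (s := isIsomorphicSetoid C) h

theorem cls_eq_of_hom {X Y : C} (f : X ⟶ Y) : A.cls X = A.cls Y := by
  have := A.isAnn.isGroupoid
  exact A.cls_eq (asIso f)

/-- The isomorphism `e ⊕ e'`. -/
def plusIso {X X' Y Y' : C} (e : X ≅ X') (e' : Y ≅ Y') : A.plus X Y ≅ A.plus X' Y' where
  hom := A.plusHom e.hom e'.hom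
  inv := A.plusHom e.inv e'.inv
  hom_inv_id := by
    let _ := A.isAnn.add_monoidal.monoidal
    exact (MonoidalCategory.tensorIso e e').hom_inv_id
  inv_hom_id := by
    let _ := A.isAnn.add_monoidal.monoidal
    exact (MonoidalCategory.tensorIso e e').inv_hom_id

/-- The isomorphism `e ⊗ e'`. -/
def timesIso {X X' Y Y' : C} (e : X ≅ X') (e' : Y ≅ Y') : A.times X Y ≅ A.times X' Y' where
  hom := A.timesHom e.hom e'.hom
  inv := A.timesHom e.inv e'.inv
  hom_inv_id := by
    let _ := A.isAnn.mul_monoidal.monoidal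
    exact (MonoidalCategory.tensorIso e e').hom_inv_id
  inv_hom_id := by
    let _ := A.isAnn.mul_monoidal.monoidal
    exact (MonoidalCategory.tensorIso e e').inv_hom_id

/-- The sum `[X] + [Y] = [X ⊕ Y]` on `π₀`. -/
instance : Add A.Reduced :=
  ⟨Quotient.map₂ A.plus fun _ _ ⟨e⟩ _ _ ⟨e'⟩ => ⟨A.plusIso e e'⟩⟩

/-- The product `[X][Y] = [X ⊗ Y]` on `π₀`. -/
instance : Mul A.Reduced :=
  ⟨Quotient.map₂ A.times fun _ _ ⟨e⟩ _ _ ⟨e'⟩ => ⟨A.timesIso e e'⟩⟩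

instance : Zero A.Reduced := ⟨A.cls A.zero⟩

instance : One A.Reduced := ⟨A.cls A.one⟩

theorem cls_plus (X Y : C) : A.cls (A.plus X Y) = A.cls X + A.cls Y := rfl

theorem cls_times (X Y : C) : A.cls (A.times X Y) = A.cls X * A.cls Y := rfl

/-- The functor `- ⊕ Z`. -/
def addRight (Z : C) : C ⥤ C :=
  letI := A.isAnn.add_monoidal.monoidal
  MonoidalCategory.tensorRight Z

theorem addRight_map (Z : C) {X Y : C} (f : X ⟶ Y) :
    (A.addRight Z).map f = A.plusHom f (𝟙 Z) := by
  let _ := A.isAnn.add_monoidal.monoidal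
  exact (MonoidalCategory.tensorHom_id f Z).symm

theorem addRight_isEquivalence (Z : C) : (A.addRight Z).IsEquivalence := by
  let _ := A.isAnn.add_monoidal.monoidal
  obtain ⟨W, ⟨e⟩⟩ := A.isAnn.exists_neg Z
  let key : ∀ {U V : C}, (A.plus U V ≅ A.zero) →
      (𝟭 C ≅ MonoidalCategory.tensorRight U ⋙ MonoidalCategory.tensorRight V) := fun {U V} e =>
    ((MonoidalCategory.tensorRightTensor U V).symm ≪≫
      (MonoidalCategory.tensoringRight C).mapIso e ≪≫
      MonoidalCategory.rightUnitorNatIso C).symm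
  let e' : A.plus W Z ≅ A.zero := A.addComm W Z ≪≫ e
  exact (CategoryTheory.Equivalence.mk (MonoidalCategory.tensorRight Z)
    (MonoidalCategory.tensorRight W) (key e) (key e').symm).isEquivalence_functor

/-- The functor `- ⊕ Z` is fully faithful, since `Z` is invertible for `⊕`. -/
noncomputable def addRightFullyFaithful (Z : C) : (A.addRight Z).FullyFaithful :=
  haveI := A.addRight_isEquivalence Z
  Functor.FullyFaithful.ofFullyFaithful _

/-- The isomorphism `γ_X : Aut(0) → Aut(X)`, `γ_X(u) = g_X ∘ (u ⊕ id) ∘ g_X⁻¹` with the left unit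
constraint `g_X : 0 ⊕ X ≅ X`. -/
noncomputable def gamma (X : C) : Aut A.zero ≃* Aut X :=
  (A.addRightFullyFaithful X).autMulEquivOfFullyFaithful A.zero |>.trans
    (A.add.leftUnitor X).conjAut

theorem gamma_hom (X : C) (a : Aut A.zero) :
    (A.gamma X a).hom =
      (A.add.leftUnitor X).inv ≫ A.plusHom a.hom (𝟙 X) ≫ (A.add.leftUnitor X).hom := by
  rw [← A.addRight_map]
  rfl

/-- The isomorphism `L̂^X : X ⊗ 0 ≅ 0` induced by the `⊕`-functor `F = X ⊗ -`: it is determined by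
`F(g_0) = g_{F0} ∘ (L̂ ⊕ id) ∘ 𝔏_{X,0,0}` as a morphism `F(0 ⊕ 0) ⟶ F0`. -/
noncomputable def lHat (X : C) : A.times X A.zero ≅ A.zero :=
  (A.addRightFullyFaithful (A.times X A.zero)).preimageIso
    ((A.distL X A.zero A.zero).symm ≪≫
      A.timesIso (Iso.refl X) (A.add.leftUnitor A.zero) ≪≫
      (A.add.leftUnitor (A.times X A.zero)).symm)

theorem lHat_spec (X : C) :
    (A.distL X A.zero A.zero).hom ≫ A.plusHom (A.lHat X).hom (𝟙 _) ≫
        (A.add.leftUnitor (A.times X A.zero)).hom =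
      A.timesHom (𝟙 X) (A.add.leftUnitor A.zero).hom := by
  rw [← A.addRight_map, lHat, Functor.FullyFaithful.preimageIso_hom,
    Functor.FullyFaithful.map_preimage]
  change _ ≫ ((A.distL X A.zero A.zero).inv ≫ A.timesHom (𝟙 X) (A.add.leftUnitor A.zero).hom ≫
    (A.add.leftUnitor (A.times X A.zero)).inv) ≫ _ = _
  rw [Category.assoc, Category.assoc, Iso.inv_hom_id, Category.comp_id, Iso.hom_inv_id_assoc]

/-- The isomorphism `R̂^X : 0 ⊗ X ≅ 0` induced by the `⊕`-functor `F = - ⊗ X`: it is determined by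
`F(g_0) = g_{F0} ∘ (R̂ ⊕ id) ∘ ℜ_{0,0,X}` as a morphism `F(0 ⊕ 0) ⟶ F0`. -/
noncomputable def rHat (X : C) : A.times A.zero X ≅ A.zero :=
  (A.addRightFullyFaithful (A.times A.zero X)).preimageIso
    ((A.distR A.zero A.zero X).symm ≪≫
      A.timesIso (A.add.leftUnitor A.zero) (Iso.refl X) ≪≫
      (A.add.leftUnitor (A.times A.zero X)).symm)

theorem rHat_spec (X : C) :
    (A.distR A.zero A.zero X).hom ≫ A.plusHom (A.rHat X).hom (𝟙 _) ≫
        (A.add.leftUnitor (A.times A.zero X)).hom =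
      A.timesHom (A.add.leftUnitor A.zero).hom (𝟙 X) := by
  rw [← A.addRight_map, rHat, Functor.FullyFaithful.preimageIso_hom,
    Functor.FullyFaithful.map_preimage]
  change _ ≫ ((A.distR A.zero A.zero X).inv ≫ A.timesHom (A.add.leftUnitor A.zero).hom (𝟙 X) ≫
    (A.add.leftUnitor (A.times A.zero X)).inv) ≫ _ = _
  rw [Category.assoc, Category.assoc, Iso.inv_hom_id, Category.comp_id, Iso.hom_inv_id_assoc]

/-- The map `λ_X : Aut(0) → Aut(0)`, `λ_X(u) = L̂^X ∘ (id ⊗ u) ∘ (L̂^X)⁻¹`. -/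
noncomputable def lam (X : C) (a : Aut A.zero) : Aut A.zero :=
  (A.lHat X).symm ≪≫ A.timesIso (Iso.refl X) a ≪≫ A.lHat X

/-- The map `ρ_X : Aut(0) → Aut(0)`, `ρ_X(u) = R̂^X ∘ (u ⊗ id) ∘ (R̂^X)⁻¹`. -/
noncomputable def rho (X : C) (a : Aut A.zero) : Aut A.zero :=
  (A.rHat X).symm ≪≫ A.timesIso a (Iso.refl X) ≪≫ A.rHat X

theorem zero_add (s : A.Reduced) : 0 + s = s :=
  Quotient.inductionOn s fun X => A.cls_eq (A.add.leftUnitor X)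

theorem add_zero (s : A.Reduced) : s + 0 = s :=
  Quotient.inductionOn s fun X => A.cls_eq (A.add.rightUnitor X)

theorem one_mul (s : A.Reduced) : 1 * s = s :=
  Quotient.inductionOn s fun X => A.cls_eq (A.mul.leftUnitor X)

theorem mul_one (s : A.Reduced) : s * 1 = s :=
  Quotient.inductionOn s fun X => A.cls_eq (A.mul.rightUnitor X)

theorem zero_mul (s : A.Reduced) : 0 * s = 0 :=
  Quotient.inductionOn s fun X => A.cls_eq (A.rHat X)

theorem mul_zero (s : A.Reduced) : s * 0 = 0 :=
  Quotient.inductionOn s fun X => A.cls_eq (A.lHat X)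

end

/-! ### Sticks -/

/-- A stick: representatives `X_s` (`rep s`) of the classes with `X_0 = 0`, `X_1 = 1`, and
isomorphisms `φ_{s,t} : X_s ⊕ X_t ≅ X_{s+t}`, `ψ_{s,t} : X_s ⊗ X_t ≅ X_{st}` which are the unit
constraints, respectively `R̂`, `L̂`, when one of the arguments is `0` or `1`. The transports
`eqToHom` only identify equal objects such as `X_0 ⊕ X_t = 0 ⊕ X_t` or `X_{0+t} = X_t`. -/
structure Stick {C : Type u} [Category.{v} C] (A : AnnCategory C) where
  rep : A.Reduced → C
  cls_rep : ∀ s, A.cls (rep s) = s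
  rep_zero : rep 0 = A.zero
  rep_one : rep 1 = A.one
  φ : ∀ s t, A.plus (rep s) (rep t) ≅ rep (s + t)
  ψ : ∀ s t, A.times (rep s) (rep t) ≅ rep (s * t)
  φ_zero_left : ∀ t, (φ 0 t).hom ≫ eqToHom (by rw [A.zero_add]) =
    eqToHom (by rw [rep_zero]) ≫ (A.add.leftUnitor (rep t)).hom
  φ_zero_right : ∀ s, (φ s 0).hom ≫ eqToHom (by rw [A.add_zero]) =
    eqToHom (by rw [rep_zero]) ≫ (A.add.rightUnitor (rep s)).hom
  ψ_one_left : ∀ t, (ψ 1 t).hom ≫ eqToHom (by rw [A.one_mul]) =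
    eqToHom (by rw [rep_one]) ≫ (A.mul.leftUnitor (rep t)).hom
  ψ_one_right : ∀ s, (ψ s 1).hom ≫ eqToHom (by rw [A.mul_one]) =
    eqToHom (by rw [rep_one]) ≫ (A.mul.rightUnitor (rep s)).hom
  ψ_zero_left : ∀ t, (ψ 0 t).hom ≫ eqToHom (by rw [A.zero_mul, rep_zero]) =
    eqToHom (by rw [rep_zero]) ≫ (A.rHat (rep t)).hom
  ψ_zero_right : ∀ s, (ψ s 0).hom ≫ eqToHom (by rw [A.mul_zero, rep_zero]) =
    eqToHom (by rw [rep_zero]) ≫ (A.lHat (rep s)).hom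

namespace Stick

section
variable {C : Type u} [Category.{v} C] {A : AnnCategory C} (σ : A.Stick)

/-- The canonical functor `H`: `H(s) = X_s`, `H(s, u) = γ_{X_s}(u)`. -/
noncomputable abbrev H : A.Reduced ⥤ C where
  obj s := σ.rep s
  map {r s} f := (A.gamma (σ.rep r) f.aut).hom ≫ eqToHom (congrArg σ.rep f.eq)
  map_id r := by
    change (A.gamma (σ.rep r) 1).hom ≫ _ = _
    rw [map_one]
    exact Category.comp_id _
  map_comp {r s t} f g := by
    obtain ⟨rfl, a⟩ := f
    obtain ⟨rfl, b⟩ := g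
    change (A.gamma (σ.rep r) (b * a)).hom ≫ 𝟙 _ =
      ((A.gamma (σ.rep r) a).hom ≫ 𝟙 _) ≫ (A.gamma (σ.rep r) b).hom ≫ 𝟙 _
    rw [map_mul, Category.comp_id, Category.comp_id, Category.comp_id]
    rfl

theorem eq_of_hom {r s : A.Reduced} (f : σ.rep r ⟶ σ.rep s) : r = s := by
  rw [← σ.cls_rep r, ← σ.cls_rep s]
  exact A.cls_eq_of_hom f

/-- A morphism `f : X_r ⟶ X_s` as an automorphism of `X_r`, using `r = s`. -/
noncomputable def homToAut {r s : A.Reduced} (f : σ.rep r ⟶ σ.rep s) : Aut (σ.rep r) :=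
  letI := A.isAnn.isGroupoid
  asIso (X := σ.rep r) (Y := σ.rep r) (f ≫ eqToHom (congrArg σ.rep (σ.eq_of_hom f).symm))

theorem homToAut_comp {r s : A.Reduced} (f : σ.rep r ⟶ σ.rep s) :
    (σ.homToAut f).hom ≫ eqToHom (congrArg σ.rep (σ.eq_of_hom f)) = f := by
  change (f ≫ eqToHom _) ≫ eqToHom _ = f
  simp

/-- `H` is fully faithful: a morphism `f : X_r ⟶ X_s` is `H(r, γ_{X_r}⁻¹(f))`, where `r = s`. -/
noncomputable def fullyFaithfulH : σ.H.FullyFaithful where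
  preimage {r s} f := ⟨σ.eq_of_hom f, (A.gamma (σ.rep r)).symm (σ.homToAut f)⟩
  map_preimage {r s} f := by
    change (A.gamma (σ.rep r) ((A.gamma (σ.rep r)).symm (σ.homToAut f))).hom ≫ _ = f
    rw [MulEquiv.apply_symm_apply]
    exact σ.homToAut_comp f
  preimage_map {r s} f := by
    obtain ⟨rfl, a⟩ := f
    apply AnnData.ReducedHom.ext
    change (A.gamma (σ.rep r)).symm
      (σ.homToAut ((A.gamma (σ.rep r) a).hom ≫ 𝟙 (σ.rep r))) = a
    rw [MulEquiv.symm_apply_eq]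
    apply Iso.ext
    change ((A.gamma (σ.rep r) a).hom ≫ 𝟙 _) ≫ 𝟙 _ = _
    rw [Category.comp_id, Category.comp_id]

/-- The operation `⊕` of the reduced category: `s ⊕ t = s + t`,
`(s, u) ⊕ (t, v) = (s + t, u + v)` (the sum of `π₁ = Aut(0)` is its composition), with unit
constraint `(0, id, id)` and the associativity constraint which corresponds to that of the
original category via `(H, φ)`. -/
noncomputable abbrev addStruct : MonoidalCategoryStruct A.Reduced where
  tensorObj s t := s + t
  whiskerLeft s _ _ f := ⟨by rw [f.eq], f.aut⟩
  whiskerRight f t := ⟨by rw [f.eq], f.aut⟩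
  tensorHom f g := ⟨by rw [f.eq, g.eq], f.aut * g.aut⟩
  tensorUnit := 0
  associator r s t := σ.fullyFaithfulH.preimageIso
    ((σ.φ (r + s) t).symm ≪≫ A.plusIso (σ.φ r s).symm (Iso.refl _) ≪≫
      A.add.associator (σ.rep r) (σ.rep s) (σ.rep t) ≪≫
      A.plusIso (Iso.refl _) (σ.φ s t) ≪≫ σ.φ r (s + t))
  leftUnitor s := A.reducedIso (A.zero_add s) 1
  rightUnitor s := A.reducedIso (A.add_zero s) 1

/-- The operation `⊗` of the reduced category: `s ⊗ t = st`, `(s, u) ⊗ (t, v) = (st, sv + ut)`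
(the sum of `π₁ = Aut(0)` is its composition, and `sv = λ_{X_s}(v)`, `ut = ρ_{X_t}(u)`), with unit
constraint `(1, id, id)` and the associativity constraint which corresponds to that of the
original category via `(H, ψ)`. -/
noncomputable abbrev mulStruct : MonoidalCategoryStruct A.Reduced where
  tensorObj s t := s * t
  whiskerLeft s _ _ f := ⟨by rw [f.eq], A.lam (σ.rep s) f.aut⟩
  whiskerRight f t := ⟨by rw [f.eq], A.rho (σ.rep t) f.aut⟩
  tensorHom {s _ t _} f g :=
    ⟨by rw [f.eq, g.eq], A.lam (σ.rep s) g.aut * A.rho (σ.rep t) f.aut⟩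
  tensorUnit := 1
  associator r s t := σ.fullyFaithfulH.preimageIso
    ((σ.ψ (r * s) t).symm ≪≫ A.timesIso (σ.ψ r s).symm (Iso.refl _) ≪≫
      A.mul.associator (σ.rep r) (σ.rep s) (σ.rep t) ≪≫
      A.timesIso (Iso.refl _) (σ.ψ s t) ≪≫ σ.ψ r (s * t))
  leftUnitor s := A.reducedIso (A.one_mul s) 1
  rightUnitor s := A.reducedIso (A.mul_one s) 1

/-- The reduced Ann-category `sA` determined by a stick: its commutativity constraint of `⊕` and
its distributivity constraints correspond to those of `A` via `(H, φ, ψ)`. -/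
noncomputable abbrev reduced : AnnData A.Reduced where
  add := σ.addStruct
  mul := σ.mulStruct
  addComm s t := σ.fullyFaithfulH.preimageIso
    ((σ.φ s t).symm ≪≫ A.addComm (σ.rep s) (σ.rep t) ≪≫ σ.φ t s)
  distL r s t := σ.fullyFaithfulH.preimageIso
    ((σ.ψ r (s + t)).symm ≪≫ A.timesIso (Iso.refl _) (σ.φ s t).symm ≪≫
      A.distL (σ.rep r) (σ.rep s) (σ.rep t) ≪≫
      A.plusIso (σ.ψ r s) (σ.ψ r t) ≪≫ σ.φ (r * s) (r * t))
  distR s t r := σ.fullyFaithfulH.preimageIso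
    ((σ.ψ (s + t) r).symm ≪≫ A.timesIso (σ.φ s t).symm (Iso.refl _) ≪≫
      A.distR (σ.rep s) (σ.rep t) (σ.rep r) ≪≫
      A.plusIso (σ.ψ s r) (σ.ψ t r) ≪≫ σ.φ (s * r) (t * r))

/-- `H` with the constraints given by `φ` and `ψ` and with `H_* = id_1`. -/
noncomputable abbrev annH : AnnFunctorData σ.reduced A.toAnnData where
  functor := σ.H
  addIso s t := σ.φ s t
  mulIso s t := σ.ψ s t
  oneIso := eqToIso σ.rep_one.symm

/-- Isomorphisms `i_X : X ≅ X_s` for `X` in the class `s`, with `i_{X_s} = id`. -/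
structure Retraction where
  i : ∀ X : C, X ≅ σ.rep (A.cls X)
  i_rep : ∀ s, (i (σ.rep s)).hom = eqToHom (by rw [σ.cls_rep])

variable {σ} (ι : σ.Retraction)

theorem Retraction.conj_comp {X Y Z : C} (f : X ⟶ Y) (g : Y ⟶ Z) :
    (ι.i X).inv ≫ (f ≫ g) ≫ (ι.i Z).hom =
      ((ι.i X).inv ≫ f ≫ (ι.i Y).hom) ≫ (ι.i Y).inv ≫ g ≫ (ι.i Z).hom := by
  simp

/-- The canonical functor `G`: `G(X) = [X] = s`, `G(f) = (s, γ_{X_s}⁻¹(i_Y f i_X⁻¹))`. -/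
noncomputable abbrev Retraction.G : C ⥤ A.Reduced where
  obj X := A.cls X
  map {X Y} f := σ.fullyFaithfulH.preimage (X := A.cls X) (Y := A.cls Y)
    ((ι.i X).inv ≫ f ≫ (ι.i Y).hom)
  map_id X := σ.fullyFaithfulH.map_injective (by
    rw [σ.fullyFaithfulH.map_preimage, σ.H.map_id]
    exact (congrArg ((ι.i X).inv ≫ ·) (Category.id_comp _)).trans (ι.i X).inv_hom_id)
  map_comp {X Y Z} f g := σ.fullyFaithfulH.map_injective (by
    rw [σ.fullyFaithfulH.map_preimage, σ.H.map_comp, σ.fullyFaithfulH.map_preimage,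
      σ.fullyFaithfulH.map_preimage]
    exact ι.conj_comp f g)

/-- `G` with its constraints. The constraint `G(X ⊕ Y) ⟶ GX ⊕ GY` is
`G(φ_{s,t} ∘ (i_X ⊕ i_Y))` for `X ∈ s`, `Y ∈ t`, where `G(X_{s+t}) = s + t`; similarly for `⊗` with
`ψ`. The fields below are the inverses of these constraints. Also `G_* = id_1`. -/
noncomputable abbrev Retraction.annG : AnnFunctorData A.toAnnData σ.reduced where
  functor := ι.G
  addIso X Y := (ι.G.mapIso (A.plusIso (ι.i X) (ι.i Y) ≪≫ σ.φ (A.cls X) (A.cls Y)) ≪≫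
    eqToIso (σ.cls_rep (A.cls X + A.cls Y))).symm
  mulIso X Y := (ι.G.mapIso (A.timesIso (ι.i X) (ι.i Y) ≪≫ σ.ψ (A.cls X) (A.cls Y)) ≪≫
    eqToIso (σ.cls_rep (A.cls X * A.cls Y))).symm
  oneIso := Iso.refl _

/-- The stick isomorphisms come from the family `i`: `φ_{s,t} = i_{X_s ⊕ X_t}` and
`ψ_{s,t} = i_{X_s ⊗ X_t}`. -/
def Retraction.Compatible : Prop :=
  (∀ s t, (σ.φ s t).hom = (ι.i (A.plus (σ.rep s) (σ.rep t))).hom ≫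
    eqToHom (by rw [A.cls_plus, σ.cls_rep, σ.cls_rep])) ∧
  (∀ s t, (σ.ψ s t).hom = (ι.i (A.times (σ.rep s) (σ.rep t))).hom ≫
    eqToHom (by rw [A.cls_times, σ.cls_rep, σ.cls_rep]))

end

end Stick

end AnnCategory

/-! ### The induced braiding -/

namespace BraidedAnnCategory

section
variable {C : Type u} [Category.{v} C] (A : BraidedAnnCategory C)

theorem mul_comm (r s : A.toAnnCategory.Reduced) : r * s = s * r :=
  Quotient.inductionOn₂ r s fun X Y =>
    A.toAnnCategory.cls_eq (X := A.times X Y) (Y := A.times Y X) (A.comm X Y)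

variable {A}

/-- The reduced Ann-category `sA` with the family of isomorphisms `(•, β(r,s)) : rs ⟶ sr`. -/
noncomputable abbrev braidedReduced (σ : A.toAnnCategory.Stick)
    (β : A.toAnnCategory.Reduced → A.toAnnCategory.Reduced → Aut A.zero) :
    BraidedAnnData A.toAnnCategory.Reduced :=
  { σ.reduced with
    comm := fun r s => A.toAnnCategory.reducedIso (A.mul_comm r s) (β r s) }

/-- The square which determines the induced braiding:
`γ_{X_{rs}}(β(r,s)) ∘ ψ_{r,s} = ψ_{s,r} ∘ c_{X_r,X_s}`, where `X_{rs} = X_{sr}`. -/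
def IsInducedBraiding (σ : A.toAnnCategory.Stick)
    (β : A.toAnnCategory.Reduced → A.toAnnCategory.Reduced → Aut A.zero) : Prop :=
  ∀ r s, (σ.ψ r s).hom ≫ (A.toAnnCategory.gamma (σ.rep (r * s)) (β r s)).hom ≫
      eqToHom (congrArg σ.rep (A.mul_comm r s)) =
    (A.comm (σ.rep r) (σ.rep s)).hom ≫ (σ.ψ s r).hom

end

end BraidedAnnCategory

/-! ### Lifting monoidal structures along faithful functors -/

section Faithful

variable {C : Type u} [Category.{v} C] {C' : Type u'} [Category.{v'} C']

/-! The reduced category carries exactly the structure that makes the equivalence `H` preserve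
everything, so its axioms are those of $\mathcal A$ read through `H`. To make this uniform, a
morphism $f$ of the source is said to lie over a morphism $e$ of the target when the comparison
morphisms built from $\breve F$, $\tilde F$, $F_*$ intertwine $F(f)$ with $e$ (`IsOver`). Every
operation and constraint preserves this relation, and for faithful $F$ into a groupoid an equation
upstairs follows from the equation below it (`IsOver.eq_of_eq`). All distributivity and braiding
axioms descend in this way (`isBraidedAnn_source`).

What is not formal is that the prescribed operations on morphisms agree with those of $\mathcal A$,
namely $\gamma(u)\oplus\gamma(v)=\gamma(u+v)$ and $\gamma(u)\otimes\gamma(v)=\gamma(sv+ut)$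
(`plusHom_gamma`, `timesHom_gamma`). The first holds because $\gamma(u)$ is natural and compatible
with whiskering on both sides; the second because $\hat L$ and $\hat R$, defined from the unit
constraint at $0$ alone, are compatible with the unit constraint at every object
(`map_leftUnitor_of_unit`).

Since `H` is full, the square for $\beta(r,s)$ has a solution; since $\gamma$ is injective, only
one. The square says that `H` is braided. The constraints of `G` are those for which
$i^{-1}:HG\cong\mathrm{id}$ is a morphism for both operations (`isAnnMorphism_isoHG`). Faithfulness
of `H` then makes `G` a braided Ann-functor (`inverse`), and full faithfulness lifts the same
isomorphism to $GH\cong\mathrm{id}$ (`exists_comp_iso_id`). -/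

/-- `(F, μ, ε)` satisfies the axioms of a strong monoidal functor, and the whiskerings of `m` are
tensor products with identities. -/
structure IsMonoidalComparison (m : MonoidalCategoryStruct C) (n : MonoidalCategoryStruct C')
    (F : C ⥤ C') (μ : ∀ X Y, n.tensorObj (F.obj X) (F.obj Y) ≅ F.obj (m.tensorObj X Y))
    (ε : n.tensorUnit ≅ F.obj m.tensorUnit) : Prop where
  whiskerLeft_eq : ∀ (X : C) {Y Y' : C} (f : Y ⟶ Y'), m.whiskerLeft X f = m.tensorHom (𝟙 X) f
  whiskerRight_eq : ∀ {X X' : C} (f : X ⟶ X') (Y : C), m.whiskerRight f Y = m.tensorHom f (𝟙 Y)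
  natural : ∀ {X X' Y Y' : C} (f : X ⟶ X') (g : Y ⟶ Y'),
    n.tensorHom (F.map f) (F.map g) ≫ (μ X' Y').hom = (μ X Y).hom ≫ F.map (m.tensorHom f g)
  assoc : ∀ X Y Z : C,
    n.tensorHom (μ X Y).hom (𝟙 (F.obj Z)) ≫ (μ (m.tensorObj X Y) Z).hom ≫
        F.map (m.associator X Y Z).hom =
      (n.associator (F.obj X) (F.obj Y) (F.obj Z)).hom ≫
        n.tensorHom (𝟙 (F.obj X)) (μ Y Z).hom ≫ (μ X (m.tensorObj Y Z)).hom
  unit_left : ∀ X : C, (n.leftUnitor (F.obj X)).hom =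
    n.tensorHom ε.hom (𝟙 (F.obj X)) ≫ (μ m.tensorUnit X).hom ≫ F.map (m.leftUnitor X).hom
  unit_right : ∀ X : C, (n.rightUnitor (F.obj X)).hom =
    n.tensorHom (𝟙 (F.obj X)) ε.hom ≫ (μ X m.tensorUnit).hom ≫ F.map (m.rightUnitor X).hom

namespace IsMonoidalComparison

variable {m : MonoidalCategoryStruct C} {n : MonoidalCategoryStruct C'} {F : C ⥤ C'}
  {μ : ∀ X Y, n.tensorObj (F.obj X) (F.obj Y) ≅ F.obj (m.tensorObj X Y)}
  {ε : n.tensorUnit ≅ F.obj m.tensorUnit}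

-- Under the faithful $F$ each constraint of `m` becomes the conjugate by `μ` and `ε` of the one of
-- `n`, so every axiom of `m` is the image of an axiom of `n`.
open MonoidalCategory in
theorem isMonoidal [F.Faithful] (h : IsMonoidalComparison m n F μ ε) (hn : IsMonoidal n) :
    IsMonoidal m := by
  obtain ⟨N, rfl⟩ := hn
  have hnat : ∀ {X X' Y Y' : C} (f : X ⟶ X') (g : Y ⟶ Y'),
      F.map (f ⊗ₘ g) = (μ X Y).inv ≫ (F.map f ⊗ₘ F.map g) ≫ (μ X' Y').hom := fun f g => by
    rw [h.natural f g, Iso.inv_hom_id_assoc]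
  refine ⟨Monoidal.induced F
    { μIso := μ
      εIso := ε
      tensorHom_eq := hnat
      whiskerLeft_eq := fun X Y Y' f => ?_
      whiskerRight_eq := fun f Y => ?_
      associator_eq := fun X Y Z => ?_
      leftUnitor_eq := fun X => ?_
      rightUnitor_eq := fun X => ?_ }, rfl⟩
  · rw [h.whiskerLeft_eq, hnat, F.map_id, id_tensorHom]
  · rw [h.whiskerRight_eq, hnat, F.map_id, tensorHom_id]
  · have := h.assoc X Y Z
    simp only [Iso.trans_hom, Iso.symm_hom, tensorIso_hom, Iso.refl_hom, Category.assoc]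
    rw [← this]
    simp
  · have := h.unit_left X
    simp only [Iso.trans_hom, Iso.symm_hom, tensorIso_hom, Iso.refl_hom, Category.assoc]
    rw [this]
    simp
  · have := h.unit_right X
    simp only [Iso.trans_hom, Iso.symm_hom, tensorIso_hom, Iso.refl_hom, Category.assoc]
    rw [this]
    simp

/-- The strong monoidal functor with the constraints `μ` and `ε`. -/
abbrev monoidalFunctor (h : IsMonoidalComparison m n F μ ε) (hm : IsMonoidal m)
    (hn : IsMonoidal n) :
    letI := hm.monoidal
    letI := hn.monoidal
    F.Monoidal :=
  letI := hm.monoidal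
  letI := hn.monoidal
  Functor.CoreMonoidal.toMonoidal
    { εIso := ε
      μIso := μ
      μIso_hom_natural_left := fun f X => by
        have := h.natural f (𝟙 X)
        rw [F.map_id, ← h.whiskerRight_eq] at this
        rw [← MonoidalCategory.tensorHom_id]
        exact this
      μIso_hom_natural_right := fun X f => by
        have := h.natural (𝟙 X) f
        rw [F.map_id, ← h.whiskerLeft_eq] at this
        rw [← MonoidalCategory.id_tensorHom]
        exact this
      associativity := fun X Y Z => by
        rw [← MonoidalCategory.id_tensorHom, ← MonoidalCategory.tensorHom_id]
        exact h.assoc X Y Z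
      left_unitality := fun X => by
        rw [← MonoidalCategory.tensorHom_id]
        exact h.unit_left X
      right_unitality := fun X => by
        rw [← MonoidalCategory.id_tensorHom]
        exact h.unit_right X }

theorem isBraiding [F.Faithful] (h : IsMonoidalComparison m n F μ ε) (hm : IsMonoidal m)
    (hn : IsMonoidal n) {c : ∀ X Y : C, m.tensorObj X Y ≅ m.tensorObj Y X}
    {d : ∀ X Y : C', n.tensorObj X Y ≅ n.tensorObj Y X} (hd : IsBraiding hn d)
    (hc : ∀ X Y, (μ X Y).hom ≫ F.map (c X Y).hom = (d (F.obj X) (F.obj Y)).hom ≫ (μ Y X).hom) :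
    IsBraiding hm c := by
  obtain ⟨B, hB⟩ := hd
  let := hm.monoidal
  let := hn.monoidal
  let := h.monoidalFunctor hm hn
  exact ⟨BraidedCategory.ofFaithful F c fun X Y => by rw [hB]; exact hc X Y, fun X Y => rfl⟩

theorem isSymmetry [F.Faithful] (h : IsMonoidalComparison m n F μ ε) (hm : IsMonoidal m)
    (hn : IsMonoidal n) {c : ∀ X Y : C, m.tensorObj X Y ≅ m.tensorObj Y X}
    {d : ∀ X Y : C', n.tensorObj X Y ≅ n.tensorObj Y X} (hd : IsSymmetry hn d)
    (hc : ∀ X Y, (μ X Y).hom ≫ F.map (c X Y).hom = (d (F.obj X) (F.obj Y)).hom ≫ (μ Y X).hom) :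
    IsSymmetry hm c := by
  obtain ⟨S, hS⟩ := hd
  obtain ⟨B, hB⟩ := h.isBraiding hm hn (d := d) ⟨S.toBraidedCategory, hS⟩ hc
  have hsymm : ∀ X Y, (d X Y).hom ≫ (d Y X).hom = 𝟙 _ := fun X Y => by
    rw [← hS, ← hS]
    exact S.symmetry X Y
  let := hm.monoidal
  refine ⟨{ B with symmetry := fun X Y => F.map_injective ?_ }, hB⟩
  -- Moving `μ` past both factors with `hc` turns the double braiding of the source into that of the
  -- target, which is trivial.
  refine (cancel_epi (μ X Y).hom).1 ?_
  rw [hB, hB, F.map_comp, ← Category.assoc, hc, Category.assoc, hc, ← Category.assoc, hsymm,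
    Category.id_comp, F.map_id]
  exact (Category.comp_id _).symm

end IsMonoidalComparison

end Faithful

/-! ### Functoriality and naturality in Ann-categories -/

section Monoidal

variable {C : Type u} [Category.{v} C] {m : MonoidalCategoryStruct C}

/-- Two monoidal structures live on the same category, so neither is a global instance; the laws are
therefore recorded for the bare data `m`. -/
theorem IsMonoidal.tensorHom_comp (h : IsMonoidal m) {X X' X'' Y Y' Y'' : C} (f : X ⟶ X')
    (f' : X' ⟶ X'') (g : Y ⟶ Y') (g' : Y' ⟶ Y'') :
    m.tensorHom f g ≫ m.tensorHom f' g' = m.tensorHom (f ≫ f') (g ≫ g') :=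
  h.monoidal.tensorHom_comp_tensorHom f g f' g'

theorem IsMonoidal.tensorHom_id (h : IsMonoidal m) (X Y : C) :
    m.tensorHom (𝟙 X) (𝟙 Y) = 𝟙 (m.tensorObj X Y) :=
  h.monoidal.id_tensorHom_id X Y

theorem IsMonoidal.assoc_natural (h : IsMonoidal m) {X X' Y Y' Z Z' : C} (f : X ⟶ X')
    (g : Y ⟶ Y') (k : Z ⟶ Z') :
    m.tensorHom (m.tensorHom f g) k ≫ (m.associator X' Y' Z').hom =
      (m.associator X Y Z).hom ≫ m.tensorHom f (m.tensorHom g k) :=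
  h.monoidal.associator_naturality f g k

theorem IsMonoidal.leftUnitor_natural (h : IsMonoidal m) {X Y : C} (f : X ⟶ Y) :
    m.tensorHom (𝟙 m.tensorUnit) f ≫ (m.leftUnitor Y).hom = (m.leftUnitor X).hom ≫ f := by
  let _ := h.monoidal
  exact MonoidalCategory.id_tensorHom m.tensorUnit f ▸ MonoidalCategory.leftUnitor_naturality f

theorem IsMonoidal.rightUnitor_natural (h : IsMonoidal m) {X Y : C} (f : X ⟶ Y) :
    m.tensorHom f (𝟙 m.tensorUnit) ≫ (m.rightUnitor Y).hom = (m.rightUnitor X).hom ≫ f := by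
  let _ := h.monoidal
  exact MonoidalCategory.tensorHom_id f m.tensorUnit ▸ MonoidalCategory.rightUnitor_naturality f

theorem IsBraiding.natural {h : IsMonoidal m} {c : ∀ X Y : C, m.tensorObj X Y ≅ m.tensorObj Y X}
    (hc : IsBraiding h c) {X X' Y Y' : C} (f : X ⟶ X') (g : Y ⟶ Y') :
    m.tensorHom f g ≫ (c X' Y').hom = (c X Y).hom ≫ m.tensorHom g f := by
  obtain ⟨B, hB⟩ := hc
  let _ := h.monoidal
  rw [← hB, ← hB]
  exact BraidedCategory.braiding_naturality f g

theorem IsSymmetry.isBraiding {h : IsMonoidal m}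
    {c : ∀ X Y : C, m.tensorObj X Y ≅ m.tensorObj Y X} (hc : IsSymmetry h c) : IsBraiding h c := by
  obtain ⟨S, hS⟩ := hc
  exact ⟨S.toBraidedCategory, hS⟩

theorem AnnData.IsAnn.plusHom_id {D : AnnData C} (h : D.IsAnn) (X Y : C) :
    D.plusHom (𝟙 X) (𝟙 Y) = 𝟙 (D.plus X Y) :=
  h.add_monoidal.tensorHom_id X Y

theorem AnnData.IsAnn.timesHom_id {D : AnnData C} (h : D.IsAnn) (X Y : C) :
    D.timesHom (𝟙 X) (𝟙 Y) = 𝟙 (D.times X Y) :=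
  h.mul_monoidal.tensorHom_id X Y

end Monoidal

/-! ### Squares over an Ann-functor -/

section Squares

variable {C : Type u} [Category.{v} C] {C' : Type u'} [Category.{v'} C']

/-- The morphism `f` of the source of `F` corresponds to the morphism `e` of the target, via the
comparison morphisms `p` and `q`. -/
def IsOver (F : C ⥤ C') {X Y : C} {P Q : C'} (p : P ⟶ F.obj X) (q : Q ⟶ F.obj Y) (e : P ⟶ Q)
    (f : X ⟶ Y) : Prop :=
  p ≫ F.map f = e ≫ q

namespace IsOver

variable {F : C ⥤ C'}

theorem map {X Y : C} (f : X ⟶ Y) : IsOver F (𝟙 _) (𝟙 _) (F.map f) f := by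
  rw [IsOver, Category.id_comp, Category.comp_id]

theorem id {X : C} {P : C'} (p : P ⟶ F.obj X) : IsOver F p p (𝟙 P) (𝟙 X) := by
  rw [IsOver, F.map_id, Category.id_comp, Category.comp_id]

theorem comp {X Y Z : C} {P Q R : C'} {p : P ⟶ F.obj X} {q : Q ⟶ F.obj Y} {r : R ⟶ F.obj Z}
    {e : P ⟶ Q} {e' : Q ⟶ R} {f : X ⟶ Y} {f' : Y ⟶ Z} (h : IsOver F p q e f)
    (h' : IsOver F q r e' f') : IsOver F p r (e ≫ e') (f ≫ f') := by
  rw [IsOver, F.map_comp, ← Category.assoc, h, Category.assoc, h', Category.assoc]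

theorem inv {X Y : C} {P Q : C'} {p : P ⟶ F.obj X} {q : Q ⟶ F.obj Y} {e : P ≅ Q} {f : X ≅ Y}
    (h : IsOver F p q e.hom f.hom) : IsOver F q p e.inv f.inv := by
  rw [IsOver, Iso.eq_inv_comp, ← Category.assoc, ← h, Category.assoc, ← F.map_comp,
    Iso.hom_inv_id, F.map_id, Category.comp_id]

/-- In a groupoid the comparison `p` can be cancelled, so $F(f)$ is determined by `e`, and
faithfulness then determines `f`. Every transfer of an equation below rests on this. -/
theorem eq_of_eq [F.Faithful] [IsGroupoid C'] {X Y : C} {P Q : C'} {p : P ⟶ F.obj X}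
    {q : Q ⟶ F.obj Y} {e e' : P ⟶ Q} {f f' : X ⟶ Y} (h : IsOver F p q e f)
    (h' : IsOver F p q e' f') (he : e = e') : f = f' := by
  subst he
  exact F.map_injective ((cancel_epi p).1 (Eq.trans h (Eq.symm h')))

end IsOver

namespace AnnFunctorData

variable {D : BraidedAnnData C} {E : BraidedAnnData C'}
  (F : AnnFunctorData D.toAnnData E.toAnnData)

/-- The comparison morphism of a sum. -/
def plusCmp {X Y : C} {P Q : C'} (p : P ⟶ F.functor.obj X) (q : Q ⟶ F.functor.obj Y) :
    E.plus P Q ⟶ F.functor.obj (D.plus X Y) :=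
  E.plusHom p q ≫ (F.addIso X Y).hom

/-- The comparison morphism of a product. -/
def timesCmp {X Y : C} {P Q : C'} (p : P ⟶ F.functor.obj X) (q : Q ⟶ F.functor.obj Y) :
    E.times P Q ⟶ F.functor.obj (D.times X Y) :=
  E.timesHom p q ≫ (F.mulIso X Y).hom

variable {F} (hF : IsBraidedAnnFunctor D E F) (hE : E.IsBraidedAnn)

namespace IsBraidedAnnFunctor
include hF hE

theorem isOver_plus {X X' Y Y' : C} {P P' Q Q' : C'} {p : P ⟶ F.functor.obj X}
    {p' : P' ⟶ F.functor.obj X'} {q : Q ⟶ F.functor.obj Y} {q' : Q' ⟶ F.functor.obj Y'}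
    {e : P ⟶ P'} {e' : Q ⟶ Q'} {f : X ⟶ X'} {f' : Y ⟶ Y'} (h : IsOver F.functor p p' e f)
    (h' : IsOver F.functor q q' e' f') :
    IsOver F.functor (F.plusCmp p q) (F.plusCmp p' q') (E.plusHom e e') (D.plusHom f f') := by
  have := hE.isAnn.add_monoidal
  rw [IsOver, plusCmp, plusCmp, Category.assoc, ← hF.add_natural, ← Category.assoc,
    ← Category.assoc, this.tensorHom_comp, this.tensorHom_comp, h, h']

theorem isOver_times {X X' Y Y' : C} {P P' Q Q' : C'} {p : P ⟶ F.functor.obj X}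
    {p' : P' ⟶ F.functor.obj X'} {q : Q ⟶ F.functor.obj Y} {q' : Q' ⟶ F.functor.obj Y'}
    {e : P ⟶ P'} {e' : Q ⟶ Q'} {f : X ⟶ X'} {f' : Y ⟶ Y'} (h : IsOver F.functor p p' e f)
    (h' : IsOver F.functor q q' e' f') :
    IsOver F.functor (F.timesCmp p q) (F.timesCmp p' q') (E.timesHom e e') (D.timesHom f f') := by
  have := hE.isAnn.mul_monoidal
  rw [IsOver, timesCmp, timesCmp, Category.assoc, ← hF.mul_natural, ← Category.assoc,
    ← Category.assoc, this.tensorHom_comp, this.tensorHom_comp, h, h']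

/-- The comparisons `p`, `q`, `r` are arbitrary, not identities, so that this square and the
analogous ones for the other constraints can be pasted inside longer expressions. -/
theorem isOver_addAssoc {X Y Z : C} {P Q R : C'} (p : P ⟶ F.functor.obj X)
    (q : Q ⟶ F.functor.obj Y) (r : R ⟶ F.functor.obj Z) :
    IsOver F.functor (F.plusCmp (F.plusCmp p q) r) (F.plusCmp p (F.plusCmp q r))
      (E.add.associator P Q R).hom (D.add.associator X Y Z).hom := by
  have hm := hE.isAnn.add_monoidal
  have h₁ : E.plusHom (E.plusHom p q ≫ (F.addIso X Y).hom) r =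
      E.plusHom (E.plusHom p q) r ≫ E.plusHom (F.addIso X Y).hom (𝟙 _) := by
    rw [hm.tensorHom_comp, Category.comp_id]
  have h₂ : E.plusHom p (E.plusHom q r ≫ (F.addIso Y Z).hom) =
      E.plusHom p (E.plusHom q r) ≫ E.plusHom (𝟙 _) (F.addIso Y Z).hom := by
    rw [hm.tensorHom_comp, Category.comp_id]
  rw [IsOver, plusCmp, plusCmp, plusCmp, plusCmp, h₁, h₂, Category.assoc, Category.assoc,
    hF.add_assoc, ← Category.assoc, hm.assoc_natural, Category.assoc, Category.assoc]

theorem isOver_mulAssoc {X Y Z : C} {P Q R : C'} (p : P ⟶ F.functor.obj X)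
    (q : Q ⟶ F.functor.obj Y) (r : R ⟶ F.functor.obj Z) :
    IsOver F.functor (F.timesCmp (F.timesCmp p q) r) (F.timesCmp p (F.timesCmp q r))
      (E.mul.associator P Q R).hom (D.mul.associator X Y Z).hom := by
  have hm := hE.isAnn.mul_monoidal
  have h₁ : E.timesHom (E.timesHom p q ≫ (F.mulIso X Y).hom) r =
      E.timesHom (E.timesHom p q) r ≫ E.timesHom (F.mulIso X Y).hom (𝟙 _) := by
    rw [hm.tensorHom_comp, Category.comp_id]
  have h₂ : E.timesHom p (E.timesHom q r ≫ (F.mulIso Y Z).hom) =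
      E.timesHom p (E.timesHom q r) ≫ E.timesHom (𝟙 _) (F.mulIso Y Z).hom := by
    rw [hm.tensorHom_comp, Category.comp_id]
  rw [IsOver, timesCmp, timesCmp, timesCmp, timesCmp, h₁, h₂, Category.assoc, Category.assoc,
    hF.mul_assoc, ← Category.assoc, hm.assoc_natural, Category.assoc, Category.assoc]

theorem isOver_addComm {X Y : C} {P Q : C'} (p : P ⟶ F.functor.obj X)
    (q : Q ⟶ F.functor.obj Y) :
    IsOver F.functor (F.plusCmp p q) (F.plusCmp q p) (E.addComm P Q).hom (D.addComm X Y).hom := by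
  rw [IsOver, plusCmp, plusCmp, Category.assoc, hF.add_comm, ← Category.assoc,
    hE.isAnn.add_symmetry.isBraiding.natural, Category.assoc]

theorem isOver_mulComm {X Y : C} {P Q : C'} (p : P ⟶ F.functor.obj X)
    (q : Q ⟶ F.functor.obj Y) :
    IsOver F.functor (F.timesCmp p q) (F.timesCmp q p) (E.comm P Q).hom (D.comm X Y).hom := by
  rw [IsOver, timesCmp, timesCmp, Category.assoc, hF.mul_comm, ← Category.assoc,
    hE.comm_braiding.natural, Category.assoc]

theorem isOver_distL {X Y Z : C} {P Q R : C'} (p : P ⟶ F.functor.obj X)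
    (q : Q ⟶ F.functor.obj Y) (r : R ⟶ F.functor.obj Z) :
    IsOver F.functor (F.timesCmp p (F.plusCmp q r)) (F.plusCmp (F.timesCmp p q) (F.timesCmp p r))
      (E.distL P Q R).hom (D.distL X Y Z).hom := by
  have h₁ : E.timesHom p (E.plusHom q r ≫ (F.addIso Y Z).hom) =
      E.timesHom p (E.plusHom q r) ≫ E.timesHom (𝟙 _) (F.addIso Y Z).hom := by
    rw [hE.isAnn.mul_monoidal.tensorHom_comp, Category.comp_id]
  have h₂ : E.plusHom (E.timesHom p q ≫ (F.mulIso X Y).hom) (E.timesHom p r ≫ (F.mulIso X Z).hom) =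
      E.plusHom (E.timesHom p q) (E.timesHom p r) ≫ E.plusHom (F.mulIso X Y).hom (F.mulIso X Z).hom :=
    (hE.isAnn.add_monoidal.tensorHom_comp _ _ _ _).symm
  rw [IsOver, plusCmp, plusCmp, timesCmp, timesCmp, timesCmp, h₁, Category.assoc, Category.assoc,
    hF.distL, ← Category.assoc, hE.isAnn.distL_natural, Category.assoc,
    h₂, Category.assoc]

theorem isOver_distR {X Y Z : C} {P Q R : C'} (p : P ⟶ F.functor.obj X)
    (q : Q ⟶ F.functor.obj Y) (r : R ⟶ F.functor.obj Z) :
    IsOver F.functor (F.timesCmp (F.plusCmp p q) r) (F.plusCmp (F.timesCmp p r) (F.timesCmp q r))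
      (E.distR P Q R).hom (D.distR X Y Z).hom := by
  have h₁ : E.timesHom (E.plusHom p q ≫ (F.addIso X Y).hom) r =
      E.timesHom (E.plusHom p q) r ≫ E.timesHom (F.addIso X Y).hom (𝟙 _) := by
    rw [hE.isAnn.mul_monoidal.tensorHom_comp, Category.comp_id]
  have h₂ : E.plusHom (E.timesHom p r ≫ (F.mulIso X Z).hom) (E.timesHom q r ≫ (F.mulIso Y Z).hom) =
      E.plusHom (E.timesHom p r) (E.timesHom q r) ≫ E.plusHom (F.mulIso X Z).hom (F.mulIso Y Z).hom :=
    (hE.isAnn.add_monoidal.tensorHom_comp _ _ _ _).symm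
  rw [IsOver, plusCmp, plusCmp, timesCmp, timesCmp, timesCmp, h₁, Category.assoc, Category.assoc,
    hF.distR, ← Category.assoc, hE.isAnn.distR_natural, Category.assoc,
    h₂, Category.assoc]

/-- The object $1$ is compared through $F_*$; with this choice the unit axiom of the functor becomes
a square over the unit constraint. -/
theorem isOver_mulLeftUnitor {X : C} {P : C'} (p : P ⟶ F.functor.obj X) :
    IsOver F.functor (F.timesCmp F.oneIso.hom p) p (E.mul.leftUnitor P).hom
      (D.mul.leftUnitor X).hom := by
  have hm := hE.isAnn.mul_monoidal
  have h₁ : E.timesHom F.oneIso.hom p = E.timesHom (𝟙 _) p ≫ E.timesHom F.oneIso.hom (𝟙 _) := by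
    rw [hm.tensorHom_comp, Category.comp_id, Category.id_comp]
  rw [IsOver, timesCmp, h₁, Category.assoc, Category.assoc, ← hF.one_mul, hm.leftUnitor_natural]

theorem isOver_mulRightUnitor {X : C} {P : C'} (p : P ⟶ F.functor.obj X) :
    IsOver F.functor (F.timesCmp p F.oneIso.hom) p (E.mul.rightUnitor P).hom
      (D.mul.rightUnitor X).hom := by
  have hm := hE.isAnn.mul_monoidal
  have h₁ : E.timesHom p F.oneIso.hom = E.timesHom p (𝟙 _) ≫ E.timesHom (𝟙 _) F.oneIso.hom := by
    rw [hm.tensorHom_comp, Category.comp_id, Category.id_comp]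
  rw [IsOver, timesCmp, h₁, Category.assoc, Category.assoc, ← hF.mul_one, hm.rightUnitor_natural]

theorem isOver_interchange {X Y Z T : C} {P Q R S : C'} (p : P ⟶ F.functor.obj X)
    (q : Q ⟶ F.functor.obj Y) (r : R ⟶ F.functor.obj Z) (s : S ⟶ F.functor.obj T) :
    IsOver F.functor (F.plusCmp (F.plusCmp p q) (F.plusCmp r s))
      (F.plusCmp (F.plusCmp p r) (F.plusCmp q s)) (E.interchange P Q R S)
      (D.interchange X Y Z T) :=
  .comp (hF.isOver_addAssoc hE _ _ _) <| .comp
    (hF.isOver_plus hE (.id _) <| .comp (.inv (hF.isOver_addAssoc hE _ _ _)) <|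
      .comp (hF.isOver_plus hE (hF.isOver_addComm hE _ _) (.id _)) (hF.isOver_addAssoc hE _ _ _))
    (.inv (hF.isOver_addAssoc hE _ _ _))

end IsBraidedAnnFunctor

end AnnFunctorData

end Squares

/-! ### Transfer of structure along fully faithful functors, and their inverses -/

namespace AnnFunctorData

section
variable {C : Type u} [Category.{v} C] {C' : Type u'} [Category.{v'} C']
  {D : BraidedAnnData C} {E : BraidedAnnData C'} {F : AnnFunctorData D.toAnnData E.toAnnData}

namespace IsBraidedAnnFunctor

/-- Braided Ann-category structures lift along braided Ann-functors which are equivalences of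
categories. -/
theorem isBraidedAnn_source (hF : IsBraidedAnnFunctor D E F) (hE : E.IsBraidedAnn)
    (ff : F.functor.FullyFaithful) [F.functor.EssSurj] {ε : E.zero ≅ F.functor.obj D.zero}
    (hadd : IsMonoidalComparison D.add E.add F.functor F.addIso ε)
    (hmul : IsMonoidalComparison D.mul E.mul F.functor F.mulIso F.oneIso) : D.IsBraidedAnn := by
  have := ff.faithful
  have := ff.full
  have := hE.isAnn.isGroupoid
  have am := hadd.isMonoidal hE.isAnn.add_monoidal
  have mm := hmul.isMonoidal hE.isAnn.mul_monoidal
  refine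
    { isAnn :=
      { add_monoidal := am
        add_symmetry := hadd.isSymmetry am _ hE.isAnn.add_symmetry hF.add_comm
        isGroupoid := ⟨fun {X Y} f => isIso_of_fully_faithful F.functor f⟩
        exists_neg := fun X => ?_
        mul_monoidal := mm
        distL_natural := fun f g h => ?_
        distR_natural := fun g h f => ?_
        distL_assoc := fun X Y Z T => ?_
        distL_comm := fun X Y Z => ?_
        distR_assoc := fun X Y Z T => ?_
        distR_comm := fun X Y Z => ?_
        distL_mul := fun X Y Z T => ?_
        distR_mul := fun X Y Z T => ?_
        distL_distR := fun X Y Z T => ?_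
        dist_interchange := fun X Y Z T => ?_
        distL_one := fun X Y => ?_
        distR_one := fun X Y => ?_ }
      comm_braiding := hmul.isBraiding mm _ hE.comm_braiding hF.mul_comm
      comm_dist := fun X Y Z => ?_
      comm_zero_zero := Iso.ext ?_ }
  -- A $\oplus$-inverse of $FX$ is isomorphic to some $FY$ by essential surjectivity, and the
  -- resulting isomorphism $F(X\oplus Y)\cong F0$ lifts by full faithfulness.
  · obtain ⟨Y, ⟨e⟩⟩ := hE.isAnn.exists_neg (F.functor.obj X)
    let _ := hE.isAnn.add_monoidal.monoidal
    exact ⟨F.functor.objPreimage Y, ⟨ff.preimageIso ((F.addIso _ _).symm ≪≫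
      MonoidalCategory.tensorIso (Iso.refl _) (F.functor.objObjPreimageIso Y) ≪≫ e ≪≫ ε)⟩⟩
  -- From here on, the two sides of an axiom of `D` are shown to lie over the two sides of the same
  -- axiom of `E`, with common comparisons generated by identities at the variables.
  · exact IsOver.eq_of_eq
      (.comp (hF.isOver_times hE (.map f) (hF.isOver_plus hE (.map g) (.map h)))
        (hF.isOver_distL hE _ _ _))
      (.comp (hF.isOver_distL hE _ _ _)
        (hF.isOver_plus hE (hF.isOver_times hE (.map f) (.map g))
          (hF.isOver_times hE (.map f) (.map h))))
      (hE.isAnn.distL_natural _ _ _)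
  · exact IsOver.eq_of_eq
      (.comp (hF.isOver_times hE (hF.isOver_plus hE (.map g) (.map h)) (.map f))
        (hF.isOver_distR hE _ _ _))
      (.comp (hF.isOver_distR hE _ _ _)
        (hF.isOver_plus hE (hF.isOver_times hE (.map g) (.map f))
          (hF.isOver_times hE (.map h) (.map f))))
      (hE.isAnn.distR_natural _ _ _)
  · exact IsOver.eq_of_eq
      (.comp (hF.isOver_times hE (.id (𝟙 _)) (hF.isOver_addAssoc hE (𝟙 _) (𝟙 _) (𝟙 _))) <|
        .comp (hF.isOver_distL hE _ _ _) (hF.isOver_plus hE (.id _) (hF.isOver_distL hE _ _ _)))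
      (.comp (hF.isOver_distL hE _ _ _) <|
        .comp (hF.isOver_plus hE (hF.isOver_distL hE _ _ _) (.id _)) (hF.isOver_addAssoc hE _ _ _))
      (hE.isAnn.distL_assoc _ _ _ _)
  · exact IsOver.eq_of_eq
      (.comp (hF.isOver_times hE (.id (𝟙 _)) (hF.isOver_addComm hE (𝟙 _) (𝟙 _)))
        (hF.isOver_distL hE _ _ _))
      (.comp (hF.isOver_distL hE _ _ _) (hF.isOver_addComm hE _ _))
      (hE.isAnn.distL_comm _ _ _)
  · exact IsOver.eq_of_eq
      (.comp (hF.isOver_times hE (hF.isOver_addAssoc hE (𝟙 _) (𝟙 _) (𝟙 _)) (.id (𝟙 _))) <|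
        .comp (hF.isOver_distR hE _ _ _) (hF.isOver_plus hE (.id _) (hF.isOver_distR hE _ _ _)))
      (.comp (hF.isOver_distR hE _ _ _) <|
        .comp (hF.isOver_plus hE (hF.isOver_distR hE _ _ _) (.id _)) (hF.isOver_addAssoc hE _ _ _))
      (hE.isAnn.distR_assoc _ _ _ _)
  · exact IsOver.eq_of_eq
      (.comp (hF.isOver_times hE (hF.isOver_addComm hE (𝟙 _) (𝟙 _)) (.id (𝟙 _)))
        (hF.isOver_distR hE _ _ _))
      (.comp (hF.isOver_distR hE _ _ _) (hF.isOver_addComm hE _ _))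
      (hE.isAnn.distR_comm _ _ _)
  -- The sum $X\oplus Y$ enters the associator as a single argument, so its comparison is given
  -- explicitly as `F.plusCmp (𝟙 _) (𝟙 _)`.
  · exact IsOver.eq_of_eq
      (.comp (hF.isOver_mulAssoc hE (𝟙 _) (𝟙 _) (F.plusCmp (𝟙 _) (𝟙 _))) <|
        .comp (hF.isOver_times hE (.id _) (hF.isOver_distL hE _ _ _)) (hF.isOver_distL hE _ _ _))
      (.comp (hF.isOver_distL hE _ _ _)
        (hF.isOver_plus hE (hF.isOver_mulAssoc hE _ _ _) (hF.isOver_mulAssoc hE _ _ _)))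
      (hE.isAnn.distL_mul _ _ _ _)
  · exact IsOver.eq_of_eq
      (.comp (hF.isOver_mulAssoc hE (F.plusCmp (𝟙 _) (𝟙 _)) (𝟙 _) (𝟙 _))
        (hF.isOver_distR hE _ _ _))
      (.comp (hF.isOver_times hE (hF.isOver_distR hE _ _ _) (.id _)) <|
        .comp (hF.isOver_distR hE _ _ _)
          (hF.isOver_plus hE (hF.isOver_mulAssoc hE _ _ _) (hF.isOver_mulAssoc hE _ _ _)))
      (hE.isAnn.distR_mul _ _ _ _)
  · exact IsOver.eq_of_eq
      (.comp (hF.isOver_mulAssoc hE (𝟙 _) (F.plusCmp (𝟙 _) (𝟙 _)) (𝟙 _)) <|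
        .comp (hF.isOver_times hE (.id _) (hF.isOver_distR hE _ _ _)) (hF.isOver_distL hE _ _ _))
      (.comp (hF.isOver_times hE (hF.isOver_distL hE _ _ _) (.id _)) <|
        .comp (hF.isOver_distR hE _ _ _)
          (hF.isOver_plus hE (hF.isOver_mulAssoc hE _ _ _) (hF.isOver_mulAssoc hE _ _ _)))
      (hE.isAnn.distL_distR _ _ _ _)
  · exact IsOver.eq_of_eq
      (.comp (hF.isOver_distL hE (F.plusCmp (𝟙 _) (𝟙 _)) (𝟙 _) (𝟙 _)) <|
        .comp (hF.isOver_plus hE (hF.isOver_distR hE _ _ _) (hF.isOver_distR hE _ _ _))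
          (hF.isOver_interchange hE _ _ _ _))
      (.comp (hF.isOver_distR hE _ _ _)
        (hF.isOver_plus hE (hF.isOver_distL hE _ _ _) (hF.isOver_distL hE _ _ _)))
      (hE.isAnn.dist_interchange _ _ _ _)
  · exact IsOver.eq_of_eq
      (.comp (hF.isOver_distL hE _ (𝟙 _) (𝟙 _))
        (hF.isOver_plus hE (hF.isOver_mulLeftUnitor hE _) (hF.isOver_mulLeftUnitor hE _)))
      (hF.isOver_mulLeftUnitor hE _)
      (hE.isAnn.distL_one _ _)
  · exact IsOver.eq_of_eq
      (.comp (hF.isOver_distR hE (𝟙 _) (𝟙 _) _)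
        (hF.isOver_plus hE (hF.isOver_mulRightUnitor hE _) (hF.isOver_mulRightUnitor hE _)))
      (hF.isOver_mulRightUnitor hE _)
      (hE.isAnn.distR_one _ _)
  · exact IsOver.eq_of_eq
      (.comp (hF.isOver_distL hE (𝟙 _) (𝟙 _) (𝟙 _))
        (hF.isOver_plus hE (hF.isOver_mulComm hE _ _) (hF.isOver_mulComm hE _ _)))
      (.comp (hF.isOver_mulComm hE _ _) (hF.isOver_distR hE _ _ _))
      (hE.comm_dist _ _ _)
  -- Comparing both factors through `ε` places $c_{0,0}$ of `D` over $c_{0,0}$ of `E`, which is the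
  -- identity.
  · exact IsOver.eq_of_eq (hF.isOver_mulComm hE ε.hom ε.hom) (.id _)
      (congrArg Iso.hom hE.comm_zero_zero)

section Inverse

variable (hF : IsBraidedAnnFunctor D E F) (hE : E.IsBraidedAnn)
  {G : AnnFunctorData E.toAnnData D.toAnnData} {t : G.functor ⋙ F.functor ≅ 𝟭 C'}
  (ht : IsAnnMorphism (G.comp F) (AnnFunctorData.id E.toAnnData) t.hom)

/-- The components $t_X^{-1}:X\to FGX$ serve as comparisons for the objects $GX$. -/
theorem isOver_inverse_map {X Y : C'} (f : X ⟶ Y) :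
    IsOver F.functor (t.inv.app X) (t.inv.app Y) f (G.functor.map f) :=
  (t.inv.naturality f).symm

include hE ht

/-- Compatibility of `t` with $\oplus$, solved for the image under `F` of the constraint of `G`,
says that this constraint lies over an identity. -/
theorem isOver_inverse_addIso (X Y : C') :
    IsOver F.functor (F.plusCmp (t.inv.app X) (t.inv.app Y)) (t.inv.app (E.plus X Y)) (𝟙 _)
      (G.addIso X Y).hom := by
  have h : (F.addIso (G.functor.obj X) (G.functor.obj Y)).hom ≫ F.functor.map (G.addIso X Y).hom =
      E.plusHom (t.hom.app X) (t.hom.app Y) ≫ t.inv.app (E.plus X Y) := by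
    have h : ((F.addIso (G.functor.obj X) (G.functor.obj Y)).hom ≫
        F.functor.map (G.addIso X Y).hom) ≫ t.hom.app (E.plus X Y) =
          E.plusHom (t.hom.app X) (t.hom.app Y) :=
      (ht.add X Y).trans (Category.comp_id _)
    rw [← h, Category.assoc, Iso.hom_inv_id_app]
    exact (Category.comp_id _).symm
  rw [IsOver, plusCmp, Category.assoc, h, ← Category.assoc,
    hE.isAnn.add_monoidal.tensorHom_comp, Iso.inv_hom_id_app, Iso.inv_hom_id_app]
  exact congrArg (· ≫ _) (hE.isAnn.add_monoidal.tensorHom_id X Y)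

theorem isOver_inverse_mulIso (X Y : C') :
    IsOver F.functor (F.timesCmp (t.inv.app X) (t.inv.app Y)) (t.inv.app (E.times X Y)) (𝟙 _)
      (G.mulIso X Y).hom := by
  have h : (F.mulIso (G.functor.obj X) (G.functor.obj Y)).hom ≫ F.functor.map (G.mulIso X Y).hom =
      E.timesHom (t.hom.app X) (t.hom.app Y) ≫ t.inv.app (E.times X Y) := by
    have h : ((F.mulIso (G.functor.obj X) (G.functor.obj Y)).hom ≫
        F.functor.map (G.mulIso X Y).hom) ≫ t.hom.app (E.times X Y) =
          E.timesHom (t.hom.app X) (t.hom.app Y) :=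
      (ht.mul X Y).trans (Category.comp_id _)
    rw [← h, Category.assoc, Iso.hom_inv_id_app]
    exact (Category.comp_id _).symm
  rw [IsOver, timesCmp, Category.assoc, h, ← Category.assoc,
    hE.isAnn.mul_monoidal.tensorHom_comp, Iso.inv_hom_id_app, Iso.inv_hom_id_app]
  exact congrArg (· ≫ _) (hE.isAnn.mul_monoidal.tensorHom_id X Y)

omit hE in
theorem isOver_inverse_oneIso :
    IsOver F.functor F.oneIso.hom (t.inv.app E.one) (𝟙 _) G.oneIso.hom := by
  have h : (F.oneIso.hom ≫ F.functor.map G.oneIso.hom) ≫ t.hom.app E.one = 𝟙 _ := ht.one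
  rw [IsOver, Category.id_comp]
  have h' := congrArg (· ≫ t.inv.app E.one) h
  rw [Category.assoc, Iso.hom_inv_id_app] at h'
  exact (Category.comp_id _).symm.trans (h'.trans (Category.id_comp _))

include hF

/-- An inverse of a faithful braided Ann-functor is a braided Ann-functor. -/
theorem inverse [F.functor.Faithful] : IsBraidedAnnFunctor E D G := by
  have := hE.isAnn.isGroupoid
  have add := isOver_inverse_addIso hE ht
  have mul := isOver_inverse_mulIso hE ht
  have one := isOver_inverse_oneIso ht
  have map := @isOver_inverse_map _ _ _ _ _ _ F G t
  have pid := hE.isAnn.plusHom_id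
  have tid := hE.isAnn.timesHom_id
  refine ⟨fun f g => ?_, fun X Y Z => ?_, fun X Y => ?_, fun f g => ?_, fun X Y Z => ?_,
    fun X => ?_, fun X => ?_, fun X Y => ?_, fun X Y Z => ?_, fun X Y Z => ?_⟩
  -- The constraints of `G` lie over identities and $G(f)$ lies over $f$; hence both sides of each
  -- axiom lie over the same morphism of `E`, up to identities removed by `simp`.
  · exact IsOver.eq_of_eq (.comp (hF.isOver_plus hE (map f) (map g)) (add _ _))
      (.comp (add _ _) (map _)) (by simp)
  · exact IsOver.eq_of_eq (.comp (hF.isOver_plus hE (add _ _) (.id _)) <| .comp (add _ _) (map _))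
      (.comp (hF.isOver_addAssoc hE _ _ _) <|
        .comp (hF.isOver_plus hE (.id _) (add _ _)) (add _ _))
      (by simp [pid])
  · exact IsOver.eq_of_eq (.comp (add _ _) (map _)) (.comp (hF.isOver_addComm hE _ _) (add _ _))
      (by simp)
  · exact IsOver.eq_of_eq (.comp (hF.isOver_times hE (map f) (map g)) (mul _ _))
      (.comp (mul _ _) (map _)) (by simp)
  · exact IsOver.eq_of_eq (.comp (hF.isOver_times hE (mul _ _) (.id _)) <| .comp (mul _ _) (map _))
      (.comp (hF.isOver_mulAssoc hE _ _ _) <|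
        .comp (hF.isOver_times hE (.id _) (mul _ _)) (mul _ _))
      (by simp [tid])
  · exact IsOver.eq_of_eq (hF.isOver_mulLeftUnitor hE _)
      (.comp (hF.isOver_times hE one (.id _)) <| .comp (mul _ _) (map _)) (by simp [tid])
  · exact IsOver.eq_of_eq (hF.isOver_mulRightUnitor hE _)
      (.comp (hF.isOver_times hE (.id _) one) <| .comp (mul _ _) (map _)) (by simp [tid])
  · exact IsOver.eq_of_eq (.comp (mul _ _) (map _)) (.comp (hF.isOver_mulComm hE _ _) (mul _ _))
      (by simp)
  · exact IsOver.eq_of_eq (.comp (hF.isOver_times hE (.id _) (add _ _)) <| .comp (mul _ _) (map _))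
      (.comp (hF.isOver_distL hE _ _ _) <|
        .comp (hF.isOver_plus hE (mul _ _) (mul _ _)) (add _ _))
      (by simp [pid, tid])
  · exact IsOver.eq_of_eq (.comp (hF.isOver_times hE (add _ _) (.id _)) <| .comp (mul _ _) (map _))
      (.comp (hF.isOver_distR hE _ _ _) <|
        .comp (hF.isOver_plus hE (mul _ _) (mul _ _)) (add _ _))
      (by simp [pid, tid])

/-- A fully faithful braided Ann-functor `F` with a one-sided inverse `G` also satisfies
`GF ≅ id` as an Ann-functor. -/
theorem exists_comp_iso_id (ff : F.functor.FullyFaithful) :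
    ∃ s : F.functor ⋙ G.functor ≅ 𝟭 C,
      IsAnnMorphism (F.comp G) (AnnFunctorData.id D.toAnnData) s.hom := by
  have := ff.faithful
  have := hE.isAnn.isGroupoid
  -- The component at $X$ is the preimage under `F` of $t_{FX}:FGFX\to FX$.
  let s : F.functor ⋙ G.functor ≅ 𝟭 C :=
    NatIso.ofComponents (fun X => ff.preimageIso (t.app (F.functor.obj X))) fun {X Y} f =>
      ff.map_injective (by
        rw [F.functor.map_comp, F.functor.map_comp]
        simp only [Functor.FullyFaithful.preimageIso_hom, Functor.FullyFaithful.map_preimage]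
        exact t.hom.naturality (F.functor.map f))
  have hs : ∀ X, IsOver F.functor (t.inv.app (F.functor.obj X)) (𝟙 _) (𝟙 _) (s.hom.app X) := by
    intro X
    rw [IsOver]
    change _ ≫ F.functor.map (ff.preimage (t.hom.app (F.functor.obj X))) = _
    rw [ff.map_preimage, Iso.inv_hom_id_app]
    exact (Category.comp_id _).symm
  have add := isOver_inverse_addIso hE ht
  have mul := isOver_inverse_mulIso hE ht
  have one := isOver_inverse_oneIso ht
  have map := @isOver_inverse_map _ _ _ _ _ _ F G t
  -- The object $F(X\oplus Y)$ has two comparisons, from $FX\oplus FY$ and from itself; `addF`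
  -- passes between them, with the constraint of `F` underneath.
  have addF : ∀ X Y, IsOver F.functor (F.plusCmp (𝟙 _) (𝟙 _)) (𝟙 _) (F.addIso X Y).hom (𝟙 _) :=
    fun X Y => by
      rw [IsOver, plusCmp, F.functor.map_id, Category.comp_id, Category.comp_id]
      rw [hE.isAnn.plusHom_id, Category.id_comp]
  have mulF : ∀ X Y, IsOver F.functor (F.timesCmp (𝟙 _) (𝟙 _)) (𝟙 _) (F.mulIso X Y).hom (𝟙 _) :=
    fun X Y => by
      rw [IsOver, timesCmp, F.functor.map_id, Category.comp_id, Category.comp_id]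
      rw [hE.isAnn.timesHom_id, Category.id_comp]
  have oneF : IsOver F.functor F.oneIso.hom (𝟙 _) F.oneIso.hom (𝟙 _) := by
    rw [IsOver, F.functor.map_id]
  have pid := hE.isAnn.plusHom_id
  have tid := hE.isAnn.timesHom_id
  refine ⟨s, fun X Y => ?_, fun X Y => ?_, ?_⟩
  · exact IsOver.eq_of_eq (.comp (.comp (add _ _) (map _)) (hs _))
      (.comp (hF.isOver_plus hE (hs _) (hs _)) (addF _ _)) (by simp [pid, AnnFunctorData.id])
  · exact IsOver.eq_of_eq (.comp (.comp (mul _ _) (map _)) (hs _))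
      (.comp (hF.isOver_times hE (hs _) (hs _)) (mulF _ _)) (by simp [tid, AnnFunctorData.id])
  · exact IsOver.eq_of_eq (.comp (.comp one (map _)) (hs _)) oneF (by simp [AnnFunctorData.id])

end Inverse

end IsBraidedAnnFunctor

end

end AnnFunctorData

/-! ### Endomorphisms of the unit object -/

section UnitEndomorphism

open MonoidalCategory

variable {C : Type u} [Category.{v} C] [MonoidalCategory C]

/-- The endomorphism of `X` given by tensoring with an endomorphism of the unit object. -/
def unitEndAct (X : C) (a : 𝟙_ C ⟶ 𝟙_ C) : X ⟶ X :=
  (λ_ X).inv ≫ a ▷ X ≫ (λ_ X).hom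

theorem unitEndAct_natural (a : 𝟙_ C ⟶ 𝟙_ C) {X Y : C} (f : X ⟶ Y) :
    unitEndAct X a ≫ f = f ≫ unitEndAct Y a := by
  simp only [unitEndAct, Category.assoc, ← leftUnitor_naturality, whisker_exchange_assoc,
    leftUnitor_inv_naturality_assoc]

theorem unitEndAct_whiskerRight (a : 𝟙_ C ⟶ 𝟙_ C) (X Y : C) :
    unitEndAct X a ▷ Y = unitEndAct (X ⊗ Y) a := by
  simp [unitEndAct]

/-- Whiskering on the right needs only coherence; whiskering on the left is reduced to it by
conjugating with the braiding. -/
theorem whiskerLeft_unitEndAct [BraidedCategory C] (a : 𝟙_ C ⟶ 𝟙_ C) (X Y : C) :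
    X ◁ unitEndAct Y a = unitEndAct (X ⊗ Y) a := by
  rw [← cancel_mono (β_ X Y).hom, BraidedCategory.braiding_naturality_right,
    unitEndAct_whiskerRight, unitEndAct_natural]

/-- A functor compatible with the associator and, on the unit object, with the left unitor, is
compatible with all left unitors. -/
theorem map_leftUnitor_of_unit (F : C ⥤ C) (μ : ∀ X Y : C, F.obj (X ⊗ Y) ≅ F.obj X ⊗ F.obj Y)
    (hμ : ∀ {X X' Y Y' : C} (f : X ⟶ X') (g : Y ⟶ Y'),
      F.map (f ⊗ₘ g) ≫ (μ X' Y').hom = (μ X Y).hom ≫ (F.map f ⊗ₘ F.map g))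
    (ha : ∀ X Y Z : C, F.map (α_ X Y Z).hom ≫ (μ X (Y ⊗ Z)).hom ≫ F.obj X ◁ (μ Y Z).hom =
      (μ (X ⊗ Y) Z).hom ≫ (μ X Y).hom ▷ F.obj Z ≫ (α_ (F.obj X) (F.obj Y) (F.obj Z)).hom)
    (e : F.obj (𝟙_ C) ⟶ 𝟙_ C)
    (he : (μ (𝟙_ C) (𝟙_ C)).hom ≫ e ▷ F.obj (𝟙_ C) ≫ (λ_ (F.obj (𝟙_ C))).hom =
      F.map (λ_ (𝟙_ C)).hom) (X : C) :
    (μ (𝟙_ C) X).hom ≫ e ▷ F.obj X ≫ (λ_ (F.obj X)).hom = F.map (λ_ X).hom := by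
  have hl : ∀ {Y Y' : C} (X : C) (g : Y ⟶ Y'),
      F.map (X ◁ g) ≫ (μ X Y').hom = (μ X Y).hom ≫ F.obj X ◁ F.map g := fun X g => by
    simpa using hμ (𝟙 X) g
  have hr : ∀ {X X' : C} (f : X ⟶ X') (Y : C),
      F.map (f ▷ Y) ≫ (μ X' Y).hom = (μ X Y).hom ≫ F.map f ▷ F.obj Y := fun f Y => by
    simpa using hμ f (𝟙 Y)
  -- The claim is proved with `𝟙_ C ⊗ X` in place of `X`: associativity at `(𝟙_ C, 𝟙_ C, X)` reduces
  -- it to `he` whiskered with `F.obj X`.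
  have key : (μ (𝟙_ C) (𝟙_ C ⊗ X)).hom ≫ e ▷ F.obj (𝟙_ C ⊗ X) ≫ (λ_ (F.obj (𝟙_ C ⊗ X))).hom =
      F.map (λ_ (𝟙_ C ⊗ X)).hom := by
    rw [← cancel_mono (μ (𝟙_ C) X).hom, ← cancel_epi (F.map (α_ (𝟙_ C) (𝟙_ C) X).hom)]
    calc
      _ = (F.map (α_ (𝟙_ C) (𝟙_ C) X).hom ≫ (μ (𝟙_ C) (𝟙_ C ⊗ X)).hom ≫
          F.obj (𝟙_ C) ◁ (μ (𝟙_ C) X).hom) ≫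
          e ▷ (F.obj (𝟙_ C) ⊗ F.obj X) ≫ (λ_ (F.obj (𝟙_ C) ⊗ F.obj X)).hom := by
        simp only [Category.assoc, ← leftUnitor_naturality, whisker_exchange_assoc]
      _ = (μ (𝟙_ C ⊗ 𝟙_ C) X).hom ≫
          ((μ (𝟙_ C) (𝟙_ C)).hom ≫ e ▷ F.obj (𝟙_ C) ≫ (λ_ (F.obj (𝟙_ C))).hom) ▷ F.obj X := by
        rw [ha]
        simp
      _ = F.map (α_ (𝟙_ C) (𝟙_ C) X).hom ≫ F.map (λ_ (𝟙_ C ⊗ X)).hom ≫ (μ (𝟙_ C) X).hom := by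
        rw [he, ← hr, ← Category.assoc (F.map _), ← F.map_comp]
        congr 2
        simp
  -- Both sides are natural in the object, so the claim passes from `𝟙_ C ⊗ X` to `X` along the
  -- isomorphism `λ_ X`.
  rw [← cancel_epi (F.map (𝟙_ C ◁ (λ_ X).hom)), ← Category.assoc, hl, ← F.map_comp,
    leftUnitor_naturality, F.map_comp, ← key]
  simp only [Category.assoc, ← leftUnitor_naturality, whisker_exchange_assoc]

end UnitEndomorphism

namespace AnnCategory

section
variable {C : Type u} [Category.{v} C] (A : AnnCategory C)

theorem gamma_hom_eq_unitEndAct (X : C) (a : Aut A.zero) :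
    letI := A.isAnn.add_monoidal.monoidal
    (A.gamma X a).hom = unitEndAct X a.hom := by
  let _ := A.isAnn.add_monoidal.monoidal
  rw [gamma_hom, unitEndAct, ← MonoidalCategory.tensorHom_id]

theorem gamma_natural (a : Aut A.zero) {X Y : C} (f : X ⟶ Y) :
    (A.gamma X a).hom ≫ f = f ≫ (A.gamma Y a).hom := by
  let _ := A.isAnn.add_monoidal.monoidal
  rw [gamma_hom_eq_unitEndAct, gamma_hom_eq_unitEndAct]
  exact unitEndAct_natural _ _

theorem gamma_mul_hom (X : C) (a b : Aut A.zero) :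
    (A.gamma X (a * b)).hom = (A.gamma X b).hom ≫ (A.gamma X a).hom := by
  rw [map_mul]
  rfl

theorem gamma_one_hom (X : C) : (A.gamma X 1).hom = 𝟙 X := by
  rw [map_one]
  rfl

/-- The sum of two morphisms is a composite of two whiskerings, and each whiskering of a $\gamma$ is
again a $\gamma$. -/
theorem plusHom_gamma (X Y : C) (a b : Aut A.zero) :
    A.plusHom (A.gamma X a).hom (A.gamma Y b).hom = (A.gamma (A.plus X Y) (a * b)).hom := by
  obtain ⟨B, -⟩ := A.isAnn.add_symmetry.isBraiding
  let _ := A.isAnn.add_monoidal.monoidal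
  -- Multiplication in `Aut` reverses the order of `≫`; naturality of $\gamma$ restores the order
  -- required by `tensorHom_def`.
  rw [gamma_mul_hom, gamma_natural]
  simp only [gamma_hom_eq_unitEndAct]
  rw [← unitEndAct_whiskerRight, ← whiskerLeft_unitEndAct]
  exact MonoidalCategory.tensorHom_def _ _

/-- The isomorphism `L̂` is compatible with all left unit constraints. -/
theorem lHat_unit (X Y : C) :
    (A.distL X A.zero Y).hom ≫ A.plusHom (A.lHat X).hom (𝟙 _) ≫
        (A.add.leftUnitor (A.times X Y)).hom =
      A.timesHom (𝟙 X) (A.add.leftUnitor Y).hom := by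
  let _ := A.isAnn.add_monoidal.monoidal
  have h := map_leftUnitor_of_unit
    { obj := fun Y => A.times X Y
      map := fun f => A.timesHom (𝟙 X) f
      map_id := fun Y => A.isAnn.mul_monoidal.tensorHom_id X Y
      map_comp := fun f g => by
        rw [A.isAnn.mul_monoidal.tensorHom_comp, Category.comp_id] }
    (fun Y Z => A.distL X Y Z) (fun f g => A.isAnn.distL_natural _ f g)
    (fun Y Z T => by
      rw [← MonoidalCategory.tensorHom_id, ← MonoidalCategory.id_tensorHom]
      exact A.isAnn.distL_assoc X Y Z T)
    (A.lHat X).hom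
    (by
      rw [← MonoidalCategory.tensorHom_id]
      exact A.lHat_spec X) Y
  rw [← MonoidalCategory.tensorHom_id] at h
  exact h

/-- The isomorphism `R̂` is compatible with all left unit constraints. -/
theorem rHat_unit (X Y : C) :
    (A.distR A.zero X Y).hom ≫ A.plusHom (A.rHat Y).hom (𝟙 _) ≫
        (A.add.leftUnitor (A.times X Y)).hom =
      A.timesHom (A.add.leftUnitor X).hom (𝟙 Y) := by
  let _ := A.isAnn.add_monoidal.monoidal
  have h := map_leftUnitor_of_unit
    { obj := fun X => A.times X Y
      map := fun f => A.timesHom f (𝟙 Y)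
      map_id := fun X => A.isAnn.mul_monoidal.tensorHom_id X Y
      map_comp := fun f g => by
        rw [A.isAnn.mul_monoidal.tensorHom_comp, Category.comp_id] }
    (fun X Z => A.distR X Z Y) (fun f g => A.isAnn.distR_natural f g _)
    (fun X Z T => by
      rw [← MonoidalCategory.tensorHom_id, ← MonoidalCategory.id_tensorHom]
      exact A.isAnn.distR_assoc X Z T Y)
    (A.rHat Y).hom
    (by
      rw [← MonoidalCategory.tensorHom_id]
      exact A.rHat_spec Y) X
  rw [← MonoidalCategory.tensorHom_id] at h
  exact h

/-- Distributivity turns $\mathrm{id}_X\otimes(u\oplus\mathrm{id}_Y)$ into $(\mathrm{id}_X\otimes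
u)\oplus\mathrm{id}$; `lHat_unit` replaces $\mathrm{id}_X\otimes g_Y$ by $g_{XY}$ preceded by $\hat
L^X$, and conjugation by $\hat L^X$ is how $\lambda_X$ is defined. -/
theorem timesHom_id_gamma (X Y : C) (a : Aut A.zero) :
    A.timesHom (𝟙 X) (A.gamma Y a).hom = (A.gamma (A.times X Y) (A.lam X a)).hom := by
  have := A.isAnn.isGroupoid
  have mm := A.isAnn.mul_monoidal
  have am := A.isAnn.add_monoidal
  have h : A.timesHom (𝟙 X) (A.plusHom a.hom (𝟙 Y)) ≫ (A.distL X A.zero Y).hom =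
      (A.distL X A.zero Y).hom ≫ A.plusHom (A.timesHom (𝟙 X) a.hom) (𝟙 _) := by
    rw [A.isAnn.distL_natural, A.isAnn.timesHom_id]
  have hl : A.timesHom (𝟙 X) a.hom ≫ (A.lHat X).hom = (A.lHat X).hom ≫ (A.lam X a).hom := by
    change _ = (A.lHat X).hom ≫ (A.lHat X).inv ≫ A.timesHom (𝟙 X) a.hom ≫ (A.lHat X).hom
    rw [Iso.hom_inv_id_assoc]
  rw [← cancel_epi (A.timesHom (𝟙 X) (A.add.leftUnitor Y).hom), mm.tensorHom_comp,
    Category.comp_id, gamma_hom, Iso.hom_inv_id_assoc, gamma_hom, ← lHat_unit]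
  calc
    _ = A.timesHom (𝟙 X) (A.plusHom a.hom (𝟙 Y)) ≫
        A.timesHom (𝟙 X) (A.add.leftUnitor Y).hom := by
      rw [mm.tensorHom_comp, Category.comp_id]
    _ = (A.distL X A.zero Y).hom ≫ A.plusHom (A.timesHom (𝟙 X) a.hom ≫ (A.lHat X).hom) (𝟙 _) ≫
        (A.add.leftUnitor (A.times X Y)).hom := by
      rw [← lHat_unit, ← Category.assoc, h, Category.assoc, ← Category.assoc (A.plusHom _ _),
        am.tensorHom_comp, Category.comp_id]
    _ = _ := by
      rw [hl, Category.assoc, Category.assoc, Iso.hom_inv_id_assoc,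
        ← Category.assoc (A.plusHom _ _), am.tensorHom_comp, Category.comp_id]

theorem timesHom_gamma_id (X Y : C) (a : Aut A.zero) :
    A.timesHom (A.gamma X a).hom (𝟙 Y) = (A.gamma (A.times X Y) (A.rho Y a)).hom := by
  have := A.isAnn.isGroupoid
  have mm := A.isAnn.mul_monoidal
  have am := A.isAnn.add_monoidal
  have h : A.timesHom (A.plusHom a.hom (𝟙 X)) (𝟙 Y) ≫ (A.distR A.zero X Y).hom =
      (A.distR A.zero X Y).hom ≫ A.plusHom (A.timesHom a.hom (𝟙 Y)) (𝟙 _) := by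
    rw [A.isAnn.distR_natural, A.isAnn.timesHom_id]
  have hl : A.timesHom a.hom (𝟙 Y) ≫ (A.rHat Y).hom = (A.rHat Y).hom ≫ (A.rho Y a).hom := by
    change _ = (A.rHat Y).hom ≫ (A.rHat Y).inv ≫ A.timesHom a.hom (𝟙 Y) ≫ (A.rHat Y).hom
    rw [Iso.hom_inv_id_assoc]
  rw [← cancel_epi (A.timesHom (A.add.leftUnitor X).hom (𝟙 Y)), mm.tensorHom_comp,
    Category.comp_id, gamma_hom, Iso.hom_inv_id_assoc, gamma_hom, ← rHat_unit]
  calc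
    _ = A.timesHom (A.plusHom a.hom (𝟙 X)) (𝟙 Y) ≫
        A.timesHom (A.add.leftUnitor X).hom (𝟙 Y) := by
      rw [mm.tensorHom_comp, Category.comp_id]
    _ = (A.distR A.zero X Y).hom ≫ A.plusHom (A.timesHom a.hom (𝟙 Y) ≫ (A.rHat Y).hom) (𝟙 _) ≫
        (A.add.leftUnitor (A.times X Y)).hom := by
      rw [← rHat_unit, ← Category.assoc, h, Category.assoc, ← Category.assoc (A.plusHom _ _),
        am.tensorHom_comp, Category.comp_id]
    _ = _ := by
      rw [hl, Category.assoc, Category.assoc, Iso.hom_inv_id_assoc,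
        ← Category.assoc (A.plusHom _ _), am.tensorHom_comp, Category.comp_id]

theorem timesHom_gamma (X Y : C) (a b : Aut A.zero) :
    A.timesHom (A.gamma X a).hom (A.gamma Y b).hom =
      (A.gamma (A.times X Y) (A.lam X b * A.rho Y a)).hom := by
  rw [gamma_mul_hom, ← timesHom_gamma_id, ← timesHom_id_gamma,
    A.isAnn.mul_monoidal.tensorHom_comp, Category.comp_id, Category.id_comp]

theorem lam_one (X : C) : A.lam X 1 = 1 := by
  refine Iso.ext ?_
  change (A.lHat X).inv ≫ A.timesHom (𝟙 X) (𝟙 A.zero) ≫ (A.lHat X).hom = 𝟙 _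
  rw [A.isAnn.timesHom_id, Category.id_comp, Iso.inv_hom_id]

theorem rho_one (X : C) : A.rho X 1 = 1 := by
  refine Iso.ext ?_
  change (A.rHat X).inv ≫ A.timesHom (𝟙 A.zero) (𝟙 X) ≫ (A.rHat X).hom = 𝟙 _
  rw [A.isAnn.timesHom_id, Category.id_comp, Iso.inv_hom_id]

end

end AnnCategory

/-! ### The canonical functors of a stick -/

section EqToHom

variable {C : Type u} [Category.{v} C] {m : MonoidalCategoryStruct C}

theorem IsMonoidal.tensorHom_eqToHom_id (h : IsMonoidal m) {X X' : C} (e : X = X') (Y : C) :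
    m.tensorHom (eqToHom e) (𝟙 Y) = eqToHom (by rw [e]) := by
  subst e
  exact h.tensorHom_id _ _

theorem IsMonoidal.tensorHom_id_eqToHom (h : IsMonoidal m) (X : C) {Y Y' : C} (e : Y = Y') :
    m.tensorHom (𝟙 X) (eqToHom e) = eqToHom (by rw [e]) := by
  subst e
  exact h.tensorHom_id _ _

end EqToHom

namespace AnnCategory.Stick

section
variable {C : Type u} [Category.{v} C] {A : AnnCategory C} (σ : A.Stick)

theorem H_map_reducedIso_one {r s : A.Reduced} (h : r = s) :
    σ.H.map (A.reducedIso h 1).hom = eqToHom (congrArg σ.rep h) := by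
  change (A.gamma (σ.rep r) 1).hom ≫ _ = _
  rw [A.gamma_one_hom, Category.id_comp]

theorem H_map_preimageIso {r s : A.Reduced} (e : σ.rep r ≅ σ.rep s) :
    σ.H.map (σ.fullyFaithfulH.preimageIso e).hom = e.hom :=
  σ.fullyFaithfulH.map_preimage e.hom

/-- This justifies the formula $u+v$ for sums of morphisms in the reduced category; naturality of
$\gamma$ carries it across $\varphi$. -/
theorem H_map_plusHom {r r' s s' : A.Reduced} (f : r ⟶ r') (g : s ⟶ s') :
    A.plusHom (σ.H.map f) (σ.H.map g) ≫ (σ.φ r' s').hom =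
      (σ.φ r s).hom ≫ σ.H.map (σ.reduced.plusHom f g) := by
  obtain ⟨rfl, a⟩ := f
  obtain ⟨rfl, b⟩ := g
  change A.plusHom ((A.gamma (σ.rep r) a).hom ≫ 𝟙 _) ((A.gamma (σ.rep s) b).hom ≫ 𝟙 _) ≫ _ =
    _ ≫ (A.gamma (σ.rep (r + s)) (a * b)).hom ≫ 𝟙 _
  rw [Category.comp_id, Category.comp_id, Category.comp_id, A.plusHom_gamma, A.gamma_natural]

/-- The corresponding justification of the formula $sv+ut$ for products. -/
theorem H_map_timesHom {r r' s s' : A.Reduced} (f : r ⟶ r') (g : s ⟶ s') :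
    A.timesHom (σ.H.map f) (σ.H.map g) ≫ (σ.ψ r' s').hom =
      (σ.ψ r s).hom ≫ σ.H.map (σ.reduced.timesHom f g) := by
  obtain ⟨rfl, a⟩ := f
  obtain ⟨rfl, b⟩ := g
  change A.timesHom ((A.gamma (σ.rep r) a).hom ≫ 𝟙 _) ((A.gamma (σ.rep s) b).hom ≫ 𝟙 _) ≫ _ =
    _ ≫ (A.gamma (σ.rep (r * s)) (A.lam (σ.rep r) b * A.rho (σ.rep s) a)).hom ≫ 𝟙 _
  rw [Category.comp_id, Category.comp_id, Category.comp_id, A.timesHom_gamma, A.gamma_natural]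

/-- Associativity holds by the choice of the reduced associator. The unit axioms, with identities as
reduced unit constraints, are the normalizations of $\varphi_{0,t}$ and $\varphi_{s,0}$ in the
stick. -/
theorem isMonoidalComparison_add :
    IsMonoidalComparison σ.addStruct A.add σ.H σ.φ (eqToIso σ.rep_zero.symm) where
  whiskerLeft_eq r s s' f := AnnData.ReducedHom.ext (_root_.one_mul _).symm
  whiskerRight_eq f s := AnnData.ReducedHom.ext (_root_.mul_one _).symm
  natural f g := σ.H_map_plusHom f g
  assoc r s t := by
    refine (congrArg (fun k => _ ≫ _ ≫ k) (σ.H_map_preimageIso _)).trans ?_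
    change A.plusHom (σ.φ r s).hom (𝟙 (σ.rep t)) ≫ (σ.φ (r + s) t).hom ≫
      (σ.φ (r + s) t).inv ≫ A.plusHom (σ.φ r s).inv (𝟙 (σ.rep t)) ≫ _ = _
    rw [Iso.hom_inv_id_assoc, ← Category.assoc, A.isAnn.add_monoidal.tensorHom_comp,
      Iso.hom_inv_id, Category.comp_id, A.isAnn.add_monoidal.tensorHom_id, Category.id_comp]
    rfl
  unit_left s := by
    have h := σ.H_map_reducedIso_one (A.zero_add s)
    refine Eq.symm ((congrArg (fun k => _ ≫ _ ≫ k) h).trans ?_)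
    refine (congrArg (_ ≫ ·) (σ.φ_zero_left s)).trans ?_
    change A.plusHom (eqToHom σ.rep_zero.symm) (𝟙 _) ≫ eqToHom _ ≫ (A.add.leftUnitor (σ.rep s)).hom = _
    rw [AnnData.plusHom, A.isAnn.add_monoidal.tensorHom_eqToHom_id, eqToHom_trans_assoc]
    exact Category.id_comp _
  unit_right s := by
    have h := σ.H_map_reducedIso_one (A.add_zero s)
    refine Eq.symm ((congrArg (fun k => _ ≫ _ ≫ k) h).trans ?_)
    refine (congrArg (_ ≫ ·) (σ.φ_zero_right s)).trans ?_
    change A.plusHom (𝟙 _) (eqToHom σ.rep_zero.symm) ≫ eqToHom _ ≫ (A.add.rightUnitor (σ.rep s)).hom = _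
    rw [AnnData.plusHom, A.isAnn.add_monoidal.tensorHom_id_eqToHom, eqToHom_trans_assoc]
    exact Category.id_comp _

theorem isMonoidalComparison_mul :
    IsMonoidalComparison σ.mulStruct A.mul σ.H σ.ψ (eqToIso σ.rep_one.symm) where
  whiskerLeft_eq r s s' f := AnnData.ReducedHom.ext (by
    change _ = A.lam (σ.rep r) f.aut * A.rho (σ.rep s) 1
    rw [A.rho_one]
    exact (_root_.mul_one _).symm)
  whiskerRight_eq {r r'} f s := AnnData.ReducedHom.ext (by
    change _ = A.lam (σ.rep r) 1 * A.rho (σ.rep s) f.aut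
    rw [A.lam_one]
    exact (_root_.one_mul _).symm)
  natural f g := σ.H_map_timesHom f g
  assoc r s t := by
    refine (congrArg (fun k => _ ≫ _ ≫ k) (σ.H_map_preimageIso _)).trans ?_
    change A.timesHom (σ.ψ r s).hom (𝟙 (σ.rep t)) ≫ (σ.ψ (r * s) t).hom ≫
      (σ.ψ (r * s) t).inv ≫ A.timesHom (σ.ψ r s).inv (𝟙 (σ.rep t)) ≫ _ = _
    rw [Iso.hom_inv_id_assoc, ← Category.assoc, A.isAnn.mul_monoidal.tensorHom_comp,
      Iso.hom_inv_id, Category.comp_id, A.isAnn.mul_monoidal.tensorHom_id, Category.id_comp]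
    rfl
  unit_left s := by
    have h := σ.H_map_reducedIso_one (A.one_mul s)
    refine Eq.symm ((congrArg (fun k => _ ≫ _ ≫ k) h).trans ?_)
    refine (congrArg (_ ≫ ·) (σ.ψ_one_left s)).trans ?_
    change A.timesHom (eqToHom σ.rep_one.symm) (𝟙 _) ≫ eqToHom _ ≫ (A.mul.leftUnitor (σ.rep s)).hom = _
    rw [AnnData.timesHom, A.isAnn.mul_monoidal.tensorHom_eqToHom_id, eqToHom_trans_assoc]
    exact Category.id_comp _
  unit_right s := by
    have h := σ.H_map_reducedIso_one (A.mul_one s)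
    refine Eq.symm ((congrArg (fun k => _ ≫ _ ≫ k) h).trans ?_)
    refine (congrArg (_ ≫ ·) (σ.ψ_one_right s)).trans ?_
    change A.timesHom (𝟙 _) (eqToHom σ.rep_one.symm) ≫ eqToHom _ ≫ (A.mul.rightUnitor (σ.rep s)).hom = _
    rw [AnnData.timesHom, A.isAnn.mul_monoidal.tensorHom_id_eqToHom, eqToHom_trans_assoc]
    exact Category.id_comp _

theorem H_addComm (r s : A.Reduced) :
    (σ.φ r s).hom ≫ σ.H.map (σ.reduced.addComm r s).hom =
      (A.addComm (σ.rep r) (σ.rep s)).hom ≫ (σ.φ s r).hom := by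
  refine (congrArg (_ ≫ ·) (σ.H_map_preimageIso _)).trans ?_
  exact Iso.hom_inv_id_assoc _ _

theorem H_distL (r s t : A.Reduced) :
    A.timesHom (𝟙 (σ.rep r)) (σ.φ s t).hom ≫ (σ.ψ r (s + t)).hom ≫
        σ.H.map (σ.reduced.distL r s t).hom =
      (A.distL (σ.rep r) (σ.rep s) (σ.rep t)).hom ≫
        A.plusHom (σ.ψ r s).hom (σ.ψ r t).hom ≫ (σ.φ (r * s) (r * t)).hom := by
  refine (congrArg (fun k => _ ≫ _ ≫ k) (σ.H_map_preimageIso _)).trans ?_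
  change _ ≫ _ ≫ (σ.ψ r (s + t)).inv ≫ A.timesHom (𝟙 (σ.rep r)) (σ.φ s t).inv ≫ _ = _
  rw [Iso.hom_inv_id_assoc, ← Category.assoc, A.isAnn.mul_monoidal.tensorHom_comp,
    Iso.hom_inv_id, Category.comp_id, A.isAnn.mul_monoidal.tensorHom_id, Category.id_comp]
  rfl

theorem H_distR (r s t : A.Reduced) :
    A.timesHom (σ.φ r s).hom (𝟙 (σ.rep t)) ≫ (σ.ψ (r + s) t).hom ≫
        σ.H.map (σ.reduced.distR r s t).hom =
      (A.distR (σ.rep r) (σ.rep s) (σ.rep t)).hom ≫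
        A.plusHom (σ.ψ r t).hom (σ.ψ s t).hom ≫ (σ.φ (r * t) (s * t)).hom := by
  refine (congrArg (fun k => _ ≫ _ ≫ k) (σ.H_map_preimageIso _)).trans ?_
  change _ ≫ _ ≫ (σ.ψ (r + s) t).inv ≫ A.timesHom (σ.φ r s).inv (𝟙 (σ.rep t)) ≫ _ = _
  rw [Iso.hom_inv_id_assoc, ← Category.assoc, A.isAnn.mul_monoidal.tensorHom_comp,
    Iso.hom_inv_id, Category.comp_id, A.isAnn.mul_monoidal.tensorHom_id, Category.id_comp]
  rfl

variable {σ} (ι : σ.Retraction)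

instance essSurj_H : σ.H.EssSurj where
  mem_essImage X := ⟨A.cls X, A.iso_of_cls_eq (σ.cls_rep _)⟩

/-- The natural isomorphism `HG ≅ id` with components `i_X⁻¹`. -/
noncomputable def Retraction.isoHG : ι.G ⋙ σ.H ≅ 𝟭 C :=
  NatIso.ofComponents (fun X => (ι.i X).symm) fun {X Y} f => by
    change σ.H.map (σ.fullyFaithfulH.preimage ((ι.i X).inv ≫ f ≫ (ι.i Y).hom)) ≫ (ι.i Y).inv =
      (ι.i X).inv ≫ f
    rw [σ.fullyFaithfulH.map_preimage]
    simp

theorem Retraction.H_map_G_map {X Y : C} (f : X ⟶ Y) :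
    σ.H.map (ι.G.map f) = (ι.i X).inv ≫ f ≫ (ι.i Y).hom :=
  σ.fullyFaithfulH.map_preimage _

theorem H_map_eqToHom {r s : A.Reduced} (h : r = s) :
    σ.H.map (eqToHom h) = eqToHom (congrArg σ.rep h) :=
  eqToHom_map σ.H h

/-- The normalization $i_{X_s}=\mathrm{id}$ removes the factor $i$ at the target, leaving only a
transport. -/
theorem Retraction.H_map_G_map_eqToHom {X : C} {s : A.Reduced} (f : X ⟶ σ.rep s) :
    σ.H.map (ι.G.map f ≫ eqToHom (σ.cls_rep s)) = (ι.i X).inv ≫ f := by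
  rw [σ.H.map_comp, H_map_eqToHom, H_map_G_map, ι.i_rep]
  simp

theorem Retraction.isAnnMorphism_isoHG :
    AnnFunctorData.IsAnnMorphism (ι.annG.comp σ.annH) (AnnFunctorData.id A.toAnnData)
      ι.isoHG.hom where
  add X Y := by
    have h : σ.H.map (ι.annG.addIso X Y).inv =
        (ι.i (A.plus X Y)).inv ≫ A.plusHom (ι.i X).hom (ι.i Y).hom ≫
          (σ.φ (A.cls X) (A.cls Y)).hom :=
      ι.H_map_G_map_eqToHom _
    -- The definition of $\breve G$, solved for $i_{X\oplus Y}^{-1}$; substituting it makes the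
    -- constraints of `H` and `G` cancel.
    have h' : (ι.i (A.plus X Y)).inv = σ.H.map (ι.annG.addIso X Y).inv ≫
        (σ.φ (A.cls X) (A.cls Y)).inv ≫ A.plusHom (ι.i X).inv (ι.i Y).inv := by
      rw [h, Category.assoc, Category.assoc, Iso.hom_inv_id_assoc,
        A.isAnn.add_monoidal.tensorHom_comp, Iso.hom_inv_id, Iso.hom_inv_id,
        A.isAnn.add_monoidal.tensorHom_id, Category.comp_id]
    refine Eq.trans ?_ (Category.comp_id _).symm
    change ((σ.φ (A.cls X) (A.cls Y)).hom ≫ σ.H.map (ι.annG.addIso X Y).hom) ≫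
      (ι.i (A.plus X Y)).inv = A.plusHom (ι.i X).inv (ι.i Y).inv
    rw [h', Category.assoc, ← Category.assoc (σ.H.map _), ← σ.H.map_comp, Iso.hom_inv_id,
      σ.H.map_id]
    refine (congrArg (_ ≫ ·) (Category.id_comp _)).trans ?_
    rw [Iso.hom_inv_id_assoc]
  mul X Y := by
    have h : σ.H.map (ι.annG.mulIso X Y).inv =
        (ι.i (A.times X Y)).inv ≫ A.timesHom (ι.i X).hom (ι.i Y).hom ≫
          (σ.ψ (A.cls X) (A.cls Y)).hom :=
      ι.H_map_G_map_eqToHom _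
    have h' : (ι.i (A.times X Y)).inv = σ.H.map (ι.annG.mulIso X Y).inv ≫
        (σ.ψ (A.cls X) (A.cls Y)).inv ≫ A.timesHom (ι.i X).inv (ι.i Y).inv := by
      rw [h, Category.assoc, Category.assoc, Iso.hom_inv_id_assoc,
        A.isAnn.mul_monoidal.tensorHom_comp, Iso.hom_inv_id, Iso.hom_inv_id,
        A.isAnn.mul_monoidal.tensorHom_id, Category.comp_id]
    refine Eq.trans ?_ (Category.comp_id _).symm
    change ((σ.ψ (A.cls X) (A.cls Y)).hom ≫ σ.H.map (ι.annG.mulIso X Y).hom) ≫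
      (ι.i (A.times X Y)).inv = A.timesHom (ι.i X).inv (ι.i Y).inv
    rw [h', Category.assoc, ← Category.assoc (σ.H.map _), ← σ.H.map_comp, Iso.hom_inv_id,
      σ.H.map_id]
    refine (congrArg (_ ≫ ·) (Category.id_comp _)).trans ?_
    rw [Iso.hom_inv_id_assoc]
  one := by
    -- Stated for a variable object so that the equality $X_1=1$ can be eliminated;
    -- $i_{X_s}=\mathrm{id}$ then applies.
    have h : ∀ {X : C} {s : A.Reduced} (e : σ.rep s = X) (h : s = A.cls X),
        eqToHom e.symm ≫ eqToHom (congrArg σ.rep h) ≫ (ι.i X).inv = 𝟙 X := by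
      rintro X s rfl h
      rw [← cancel_mono (ι.i (σ.rep s)).hom, Category.assoc, Category.assoc, Iso.inv_hom_id,
        ι.i_rep]
      simp
    change (eqToHom σ.rep_one.symm ≫ σ.H.map (𝟙 (1 : A.Reduced))) ≫ (ι.i A.one).inv = 𝟙 A.one
    rw [σ.H.map_id, Category.assoc]
    exact h σ.rep_one rfl

end

end AnnCategory.Stick

/-! ### The induced braiding -/

namespace BraidedAnnCategory

section
variable {C : Type u} [Category.{v} C] {A : BraidedAnnCategory C}
  {σ : A.toAnnCategory.Stick}
  {β : A.toAnnCategory.Reduced → A.toAnnCategory.Reduced → Aut A.zero}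

/-- By fullness of `H`, $\psi_{s,r}\circ c\circ\psi_{r,s}^{-1}$ is the image of a morphism $rs\to
sr$, whose component in $\pi_1$ is $\beta(r,s)$. -/
theorem exists_isInducedBraiding (σ : A.toAnnCategory.Stick) :
    ∃ β : A.toAnnCategory.Reduced → A.toAnnCategory.Reduced → Aut A.zero,
      IsInducedBraiding σ β := by
  refine ⟨fun r s => (σ.fullyFaithfulH.preimage
    ((σ.ψ r s).inv ≫ (A.comm (σ.rep r) (σ.rep s)).hom ≫ (σ.ψ s r).hom)).aut, fun r s => ?_⟩
  refine (congrArg (_ ≫ ·) (σ.fullyFaithfulH.map_preimage _)).trans ?_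
  exact Iso.hom_inv_id_assoc _ _

theorem IsInducedBraiding.unique {β' : A.toAnnCategory.Reduced → A.toAnnCategory.Reduced →
    Aut A.zero} (h' : IsInducedBraiding σ β') (h : IsInducedBraiding σ β) : β' = β := by
  funext r s
  refine (A.toAnnCategory.gamma (σ.rep (r * s))).injective (Iso.ext ?_)
  have := (h' r s).trans (h r s).symm
  rwa [cancel_epi, cancel_mono] at this

theorem IsInducedBraiding.isBraidedAnnFunctor_annH (h : IsInducedBraiding σ β) :
    AnnFunctorData.IsBraidedAnnFunctor (braidedReduced σ β) A.toBraidedAnnData σ.annH where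
  add_natural := σ.isMonoidalComparison_add.natural
  add_assoc := σ.isMonoidalComparison_add.assoc
  add_comm := σ.H_addComm
  mul_natural := σ.isMonoidalComparison_mul.natural
  mul_assoc := σ.isMonoidalComparison_mul.assoc
  one_mul := σ.isMonoidalComparison_mul.unit_left
  mul_one := σ.isMonoidalComparison_mul.unit_right
  -- The square defining $\beta$ is precisely the compatibility of `H` with the braidings.
  mul_comm := h
  distL := σ.H_distL
  distR := σ.H_distR

end

end BraidedAnnCategory

/-! ### Stick isomorphisms that come from the family $i$ -/

namespace AnnCategory.Stick

section
variable {C : Type u} [Category.{v} C] {A : AnnCategory C} {σ : A.Stick} {ι : σ.Retraction}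

/-- Up to transport, `G` sends $i_Y$ to an identity: after the faithful `H`, the factor $i_Y$ in `k`
is the one already present in $HG(f)$. -/
theorem Retraction.G_map_comp_eqToHom {X Y : C} {s : A.Reduced} (f : X ⟶ Y) (k : Y ⟶ σ.rep s)
    (e : A.cls Y = s) (hk : k = (ι.i Y).hom ≫ eqToHom (congrArg σ.rep e)) :
    ι.G.map (f ≫ k) ≫ eqToHom (σ.cls_rep s) = ι.G.map f ≫ eqToHom e := by
  refine σ.fullyFaithfulH.map_injective ?_
  rw [ι.H_map_G_map_eqToHom, σ.H.map_comp, ι.H_map_G_map, H_map_eqToHom, hk]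
  simp

end

end AnnCategory.Stick

theorem mainTheorem4 {C : Type u} [Category.{v} C] (A : BraidedAnnCategory C)
    (σ : A.toAnnCategory.Stick) (ι : σ.Retraction) :
    (∃ β : A.toAnnCategory.Reduced → A.toAnnCategory.Reduced → Aut A.zero,
      BraidedAnnCategory.IsInducedBraiding σ β ∧
      (∀ β', BraidedAnnCategory.IsInducedBraiding σ β' → β' = β) ∧
      (BraidedAnnCategory.braidedReduced σ β).IsBraidedAnn ∧
      AnnFunctorData.IsBraidedAnnEquivalence
        (BraidedAnnCategory.braidedReduced σ β) A.toBraidedAnnData σ.annH ∧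
      AnnFunctorData.IsBraidedAnnEquivalence
        A.toBraidedAnnData (BraidedAnnCategory.braidedReduced σ β) ι.annG) ∧
    (ι.Compatible →
      (∀ X Y : C, (ι.annG.addIso X Y).inv =
        ι.G.map (A.plusHom (ι.i X).hom (ι.i Y).hom) ≫
          eqToHom (congrArg₂ (· + ·) (σ.cls_rep (A.toAnnCategory.cls X))
            (σ.cls_rep (A.toAnnCategory.cls Y)))) ∧
      (∀ X Y : C, (ι.annG.mulIso X Y).inv =
        ι.G.map (A.timesHom (ι.i X).hom (ι.i Y).hom) ≫
          eqToHom (congrArg₂ (· * ·) (σ.cls_rep (A.toAnnCategory.cls X))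
            (σ.cls_rep (A.toAnnCategory.cls Y))))) := by
  refine ⟨?_, fun hι => ⟨fun X Y => ?_, fun X Y => ?_⟩⟩
  · obtain ⟨β, hβ⟩ := BraidedAnnCategory.exists_isInducedBraiding σ
    have hH := hβ.isBraidedAnnFunctor_annH
    have ht := ι.isAnnMorphism_isoHG
    have := σ.fullyFaithfulH.faithful
    have hG : AnnFunctorData.IsBraidedAnnFunctor A.toBraidedAnnData _ ι.annG :=
      hH.inverse A.isBraidedAnn ht
    obtain ⟨s, hs⟩ := hH.exists_comp_iso_id A.isBraidedAnn ht σ.fullyFaithfulH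
    exact ⟨β, hβ, fun β' hβ' => hβ'.unique hβ,
      hH.isBraidedAnn_source A.isBraidedAnn σ.fullyFaithfulH σ.isMonoidalComparison_add
        σ.isMonoidalComparison_mul,
      -- `H` and `G` are inverse to each other, so the same two isomorphisms serve for both
      -- equivalences, in exchanged roles.
      ⟨hH, ι.annG, hG, ⟨s, hs⟩, ⟨ι.isoHG, ht⟩⟩, ⟨hG, σ.annH, hH, ⟨ι.isoHG, ht⟩, ⟨s, hs⟩⟩⟩
  · exact AnnCategory.Stick.Retraction.G_map_comp_eqToHom _ _ _ (hι.1 _ _)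
  · exact AnnCategory.Stick.Retraction.G_map_comp_eqToHom _ _ _ (hι.2 _ _)
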